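/- Let $W$ be an $N\times N$ weight matrix supported on a nonempty open interval $(x_0,x_1)$, $-\infty\le x_0<x_1\le\infty$: that is, $W:\mathbb R\to M_N(\mathbb C)$ is Hermitian matrix-valued, entrywise smooth and positive definite on $(x_0,x_1)$, identically zero outside of $(x_0,x_1)$, and has finite moments of all orders ($x^mW(x)$ is integrable for every $m\ge 0$). Put $$\langle P,Q\rangle_W=\int_{\mathbb R}P(x)W(x)Q(x)^*\,dx\qquad (P,Q\in M_N(\mathbb C[x])),$$ and let $P(x,n)$, $n=0,1,2,\dots$, be the sequence of monic orthogonal matrix polynomials of $W$: $P(x,n)$ has degree $n$ and leading coefficient $I$, and $\langle P(x,n),P(x,m)\rangle_W=0$ for $m\neq n$. Matrix differential operators with polynomial coefficients $\mathfrak D=\sum_{j=0}^{\ell}\partial_x^jA_j(x)$, $A_j\in M_N(\mathbb C[x])$, act on the right on $M_N(\mathbb C[x])$ by $F\cdot\mathfrak D=\sum_{j}F^{(j)}(x)A_j(x)$, and are multiplied so that $F\cdot(\mathfrak D_1\mathfrak D_2)=(F\cdot\mathfrak D_1)\cdot\mathfrak D_2$. Let $\mathcal D(W)$ be the algebra of all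 such operators $\mathfrak D$ for which every $P(x,n)$ is an eigenfunction: for every $n\ge 0$ there is $\Lambda(n)\in M_N(\mathbb C)$ with $P(x,n)\cdot\mathfrak D=\Lambda(n)P(x,n)$. Then $\mathcal D(W)$ is affine, i.e. finitely generated as an (associative, unital, in general noncommutative) $\mathbb C$-algebra. -/

import Mathlib

open scoped Polynomial ContDiff ComplexOrder Matrix

/-- `M_N(ℂ[x])`: the `N × N` matrices of complex polynomials. -/
abbrev MatPoly (N : ℕ) : Type := Matrix (Fin N) (Fin N) ℂ[X]

/-- A weight matrix supported on the (possibly unbounded) nonempty open interval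
`(x₀, x₁) = (lower, upper)`: a Hermitian matrix valued function of a real variable, smooth and
positive definite on the interval, identically zero outside of it, with finite moments.
(`Matrix.PosDef` includes being Hermitian.) -/
structure WeightMatrix (N : ℕ) where
  toFun : ℝ → Matrix (Fin N) (Fin N) ℂ
  lower : EReal
  upper : EReal
  lower_lt_upper : lower < upper
  smooth : ∀ i j, ContDiffOn ℝ ∞ (fun x => toFun x i j)
    {x : ℝ | lower < (x : EReal) ∧ (x : EReal) < upper}
  eq_zero : ∀ x : ℝ, ¬ (lower < (x : EReal) ∧ (x : EReal) < upper) → toFun x = 0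
  posDef : ∀ x : ℝ, lower < (x : EReal) → (x : EReal) < upper → (toFun x).PosDef
  moments : ∀ (m : ℕ) (i j), MeasureTheory.Integrable (fun x : ℝ => (x : ℂ) ^ m * toFun x i j)

namespace MatPoly

variable {N : ℕ}

/-- The value `P(x)` of a matrix polynomial at a real point. -/
noncomputable def evalAt (P : MatPoly N) (x : ℝ) : Matrix (Fin N) (Fin N) ℂ :=
  P.map (Polynomial.eval (x : ℂ))

/-- The coefficient of `x ^ k`, a complex matrix. -/
def coeffMat (P : MatPoly N) (k : ℕ) : Matrix (Fin N) (Fin N) ℂ :=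
  P.map (fun p => p.coeff k)

/-- A complex matrix as a constant matrix polynomial. -/
noncomputable def const (A : Matrix (Fin N) (Fin N) ℂ) : MatPoly N :=
  A.map Polynomial.C

/-- The entrywise derivative `F ↦ F'`. -/
noncomputable def deriv : MatPoly N →ₗ[ℂ] MatPoly N :=
  (Polynomial.derivative : ℂ[X] →ₗ[ℂ] ℂ[X]).mapMatrix

end MatPoly

namespace WeightMatrix

variable {N : ℕ}

/-- The matrix valued inner product `⟨P, Q⟩_W = ∫ P(x) W(x) Q(x)^* dx`, computed entrywise. -/
noncomputable def innerProduct (W : WeightMatrix N) (P Q : MatPoly N) :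
    Matrix (Fin N) (Fin N) ℂ :=
  Matrix.of fun i j => ∫ x : ℝ, (P.evalAt x * W.toFun x * (Q.evalAt x)ᴴ) i j

/-- `P(x,0), P(x,1), …` is the sequence of monic orthogonal matrix polynomials for `W(x)`:
`P(x,n)` has degree `n` and leading coefficient `I`, and `⟨P(x,n), P(x,m)⟩_W = 0` for `m ≠ n`. -/
structure IsMonicOrthogonalSequence (W : WeightMatrix N) (P : ℕ → MatPoly N) : Prop where
  monic : ∀ n, (P n).coeffMat n = 1
  degree_le : ∀ n k, n < k → (P n).coeffMat k = 0
  orthogonal : ∀ n m, m ≠ n → W.innerProduct (P n) (P m) = 0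

end WeightMatrix

namespace MatDiffOp

variable {N : ℕ}

/-- The right action `F · 𝔇 = ∑ⱼ F⁽ʲ⁾(x) Aⱼ(x)` of `𝔇 = ∑ⱼ ∂ₓʲ Aⱼ(x)` on matrix polynomials. -/
noncomputable def act (A : ℕ →₀ MatPoly N) (F : MatPoly N) : MatPoly N :=
  A.sum fun j Aj => (MatPoly.deriv ^ j) F * Aj

theorem act_zero (F : MatPoly N) : act 0 F = 0 := Finsupp.sum_zero_index

theorem act_add (A B : ℕ →₀ MatPoly N) (F : MatPoly N) :
    act (A + B) F = act A F + act B F :=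
  Finsupp.sum_add_index' (fun _ => mul_zero _) (fun _ _ _ => mul_add _ _ _)

theorem act_single (j : ℕ) (B F : MatPoly N) :
    act (Finsupp.single j B) F = (MatPoly.deriv ^ j) F * B :=
  Finsupp.sum_single_index (mul_zero _)

theorem deriv_mul (F G : MatPoly N) :
    MatPoly.deriv (F * G) = MatPoly.deriv F * G + F * MatPoly.deriv G := by
  ext1 i j
  simp [MatPoly.deriv, Matrix.mul_apply, Finset.sum_add_distrib]

theorem deriv_const (A : Matrix (Fin N) (Fin N) ℂ) :
    MatPoly.deriv (MatPoly.const A) = 0 := by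
  ext1 i j
  simp [MatPoly.deriv, MatPoly.const]

theorem deriv_pow_const_mul (A : Matrix (Fin N) (Fin N) ℂ) (j : ℕ) (F : MatPoly N) :
    (MatPoly.deriv ^ j) (MatPoly.const A * F) = MatPoly.const A * (MatPoly.deriv ^ j) F := by
  induction j with
  | zero => simp
  | succ j ih => simp [pow_succ', ih, deriv_mul, deriv_const]

theorem act_const_mul (A : ℕ →₀ MatPoly N) (L : Matrix (Fin N) (Fin N) ℂ) (F : MatPoly N) :
    act A (MatPoly.const L * F) = MatPoly.const L * act A F := by
  simp [act, Finsupp.sum, deriv_pow_const_mul, Finset.mul_sum, mul_assoc]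

/-- Composing with a right multiplication. -/
theorem exists_act_mul (A : ℕ →₀ MatPoly N) (B : MatPoly N) :
    ∃ C, ∀ F, act C F = act A F * B := by
  induction A using Finsupp.induction_linear with
  | zero => exact ⟨0, fun F => by simp [act_zero]⟩
  | add A A' h h' =>
    obtain ⟨C, hC⟩ := h
    obtain ⟨C', hC'⟩ := h'
    exact ⟨C + C', fun F => by simp [act_add, hC, hC', add_mul]⟩
  | single j a => exact ⟨Finsupp.single j (a * B), fun F => by rw [act_single, act_single, mul_assoc]⟩

/-- Composing with `∂ₓ`. -/
theorem exists_act_deriv (A : ℕ →₀ MatPoly N) :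
    ∃ C, ∀ F, act C F = MatPoly.deriv (act A F) := by
  induction A using Finsupp.induction_linear with
  | zero => exact ⟨0, fun F => by simp [act_zero]⟩
  | add A A' h h' =>
    obtain ⟨C, hC⟩ := h
    obtain ⟨C', hC'⟩ := h'
    exact ⟨C + C', fun F => by simp [act_add, hC, hC']⟩
  | single j a =>
    exact ⟨Finsupp.single (j + 1) a + Finsupp.single j (MatPoly.deriv a), fun F => by
      simp [act_add, act_single, deriv_mul, pow_succ']⟩

theorem exists_act_deriv_pow (A : ℕ →₀ MatPoly N) (k : ℕ) :
    ∃ C, ∀ F, act C F = (MatPoly.deriv ^ k) (act A F) := by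
  induction k with
  | zero => exact ⟨A, fun F => by simp⟩
  | succ k ih =>
    obtain ⟨C, hC⟩ := ih
    obtain ⟨C', hC'⟩ := exists_act_deriv C
    exact ⟨C', fun F => by simp [hC', hC, pow_succ']⟩

theorem exists_act_act (A B : ℕ →₀ MatPoly N) :
    ∃ C, ∀ F, act C F = act B (act A F) := by
  induction B using Finsupp.induction_linear with
  | zero => exact ⟨0, fun F => by simp [act_zero]⟩
  | add B B' h h' =>
    obtain ⟨C, hC⟩ := h
    obtain ⟨C', hC'⟩ := h'
    exact ⟨C + C', fun F => by simp [act_add, hC, hC']⟩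
  | single j b =>
    obtain ⟨C, hC⟩ := exists_act_deriv_pow A j
    obtain ⟨C', hC'⟩ := exists_act_mul C b
    exact ⟨C', fun F => by simp [hC', hC, act_single]⟩

theorem deriv_pow_X_pow (k j : ℕ) :
    (MatPoly.deriv ^ j) (Matrix.scalar (Fin N) ((Polynomial.X : ℂ[X]) ^ k)) =
      Matrix.scalar (Fin N) ((Polynomial.derivative^[j]) ((Polynomial.X : ℂ[X]) ^ k)) := by
  induction j with
  | zero => simp
  | succ j ih =>
    rw [pow_succ', Module.End.mul_apply, ih, Function.iterate_succ_apply']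
    ext1 a b
    by_cases h : a = b <;> simp [MatPoly.deriv, h]

/-- The action of differential operators on matrix polynomials is faithful: the coefficients of an
operator are determined by its action, so that an operator may be identified with its action. -/
theorem act_injective {A B : ℕ →₀ MatPoly N} (h : ∀ F, act A F = act B F) : A = B := by
  suffices H : ∀ C : ℕ →₀ MatPoly N, (∀ F, act C F = 0) → C = 0 by
    refine sub_eq_zero.1 (H (A - B) fun F => ?_)
    have := act_add (A - B) B F
    rw [sub_add_cancel, h F] at this
    simpa using this
  intro C hC
  ext1 k
  induction k using Nat.strong_induction_on with
  | _ k ih =>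
    have hk := hC (Matrix.scalar (Fin N) ((Polynomial.X : ℂ[X]) ^ k))
    rw [act, Finsupp.sum, Finset.sum_eq_single k] at hk
    · rw [deriv_pow_X_pow, Polynomial.iterate_derivative_X_pow_eq_smul] at hk
      have h2 : (k.factorial : ℂ) • C k = 0 := by
        ext1 a b
        have := congrFun (congrFun hk a) b
        simpa [Nat.descFactorial_self, ← nsmul_eq_mul] using this
      exact (smul_eq_zero.1 h2).resolve_left (by exact_mod_cast k.factorial_ne_zero)
    · intro j _ hj
      rcases lt_or_gt_of_ne hj with hj | hj
      · simp [ih j hj]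
      · rw [deriv_pow_X_pow, Polynomial.iterate_derivative_eq_zero (by simpa using hj)]
        simp
    · intro hk'
      simp [Finsupp.notMem_support_iff.1 hk']

end MatDiffOp

/-- `M_N(Ω[x])`: the algebra of matrix differential operators `∑ⱼ ∂ₓʲ Aⱼ(x)` with polynomial
coefficients, realized through its faithful action on `M_N(ℂ[x])`. Operators act on the right,
`F · (𝔇₁ 𝔇₂) = (F · 𝔇₁) · 𝔇₂`, hence the opposite of the endomorphism ring; `F · 𝔇` is
`𝔇.unop F`. -/
noncomputable def matDiffOps (N : ℕ) : Subalgebra ℂ (Module.End ℂ (MatPoly N))ᵐᵒᵖ where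
  carrier := {D | ∃ A : ℕ →₀ MatPoly N, ∀ F, D.unop F = MatDiffOp.act A F}
  mul_mem' := by
    rintro D E ⟨A, hA⟩ ⟨B, hB⟩
    obtain ⟨C, hC⟩ := MatDiffOp.exists_act_act A B
    exact ⟨C, fun F => by simp [hA, hB, hC]⟩
  add_mem' := by
    rintro D E ⟨A, hA⟩ ⟨B, hB⟩
    exact ⟨A + B, fun F => by simp [hA, hB, MatDiffOp.act_add]⟩
  algebraMap_mem' r :=
    ⟨Finsupp.single 0 (algebraMap ℂ (MatPoly N) r), fun F => by
      simp [MatDiffOp.act_single, MulOpposite.algebraMap_apply, Module.algebraMap_end_apply,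
        ← Algebra.commutes, Algebra.smul_def]⟩

/-- `𝒟(W)`: the algebra of all matrix differential operators `𝔇` for which the monic orthogonal
matrix polynomials `P(x,n)` of `W(x)` are eigenfunctions, `P(x,n) · 𝔇 = Λ(n) P(x,n)` with
`Λ(n) ∈ M_N(ℂ)`, for all `n`. -/
noncomputable def WeightMatrix.diffOpAlgebra {N : ℕ} (W : WeightMatrix N) :
    Subalgebra ℂ (Module.End ℂ (MatPoly N))ᵐᵒᵖ where
  carrier := {D | D ∈ matDiffOps N ∧
    ∀ P : ℕ → MatPoly N, W.IsMonicOrthogonalSequence P →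
      ∀ n, ∃ L : Matrix (Fin N) (Fin N) ℂ, D.unop (P n) = MatPoly.const L * P n}
  mul_mem' := by
    rintro D E ⟨hD, hD'⟩ ⟨hE, hE'⟩
    refine ⟨mul_mem hD hE, fun P hP n => ?_⟩
    obtain ⟨L, hL⟩ := hD' P hP n
    obtain ⟨M, hM⟩ := hE' P hP n
    obtain ⟨B, hB⟩ := hE
    refine ⟨L * M, ?_⟩
    have h : MatPoly.const (L * M) = MatPoly.const L * MatPoly.const M := Matrix.map_mul
    rw [MulOpposite.unop_mul, Module.End.mul_apply, hL, hB, MatDiffOp.act_const_mul, ← hB, hM, h,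
      mul_assoc]
  add_mem' := by
    rintro D E ⟨hD, hD'⟩ ⟨hE, hE'⟩
    refine ⟨add_mem hD hE, fun P hP n => ?_⟩
    obtain ⟨L, hL⟩ := hD' P hP n
    obtain ⟨M, hM⟩ := hE' P hP n
    have h : MatPoly.const (L + M) = MatPoly.const L + MatPoly.const M :=
      Matrix.map_add _ (fun _ _ => Polynomial.C_add) _ _
    exact ⟨L + M, by simp [hL, hM, h, add_mul]⟩
  algebraMap_mem' r := by
    refine ⟨(matDiffOps N).algebraMap_mem r, fun P _ n => ⟨algebraMap ℂ _ r, ?_⟩⟩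
    have h : MatPoly.const (algebraMap ℂ (Matrix (Fin N) (Fin N) ℂ) r) =
        algebraMap ℂ (MatPoly N) r := by
      ext1 i j
      by_cases hij : i = j <;> simp [MatPoly.const, hij, Matrix.algebraMap_matrix_apply]
    rw [h, ← Algebra.smul_def]
    simp [MulOpposite.algebraMap_apply]

/-!
Each `𝔇 ∈ 𝒟(W)` is determined by its eigenvalues `Λ(n)` on the monic orthogonal polynomials
`P(x,n)`. Writing `⟨P(x,n), P(x,n)⟩ = S(n) S(n)ᴴ` and passing to `S(n)⁻¹ Λ(n) S(n)` embeds `𝒟(W)`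
as an algebra of sequences of `N × N` matrices (`WeightMatrix.conjEigenvalue`). Two properties of
this algebra are used.

* It is stable under the pointwise conjugate transpose
  (`WeightMatrix.exists_adjoint_mem_diffOpAlgebra`). The conjugate transpose corresponds to the
  adjoint for the inner product, which exists because `𝔇` acts on the `P(x,n)` by eigenvalues. It
  is again a differential operator: a left linear operator on matrix polynomials is a differential
  operator exactly when its iterated commutators with `x` eventually vanish
  (`MatDiffOp.mem_matDiffOps_iff`), and this condition passes to adjoints since `x` is symmetric.
* Traces are polynomial in `n` (`WeightMatrix.exists_trace_eigenvalue_eq_eval`), because the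
  eigenvalues are.

Any such algebra is finitely generated
(`Algebra.FiniteType.of_star_closed_of_polynomial_trace`). The squared Hilbert–Schmidt norm
`tr (a aᴴ)(n)` of an element is a polynomial in `n`; its degree filters the algebra. The limit of
`n ^ (-d / 2) a(n)` along an ultrafilter identifies the degree `d` part of the associated graded
algebra with a space `V d` of `N × N` matrices, in such a way that products and conjugate
transposes are respected. A positive semidefinite `p ∈ V m`, `m > 0`, with smallest possible kernel
is left regular on every `V d` with `d > 0` (`IsGradedStarFamily.exists_regular`). As
`dim V d ≤ N ^ 2`, it follows that `p * V d = V (d + m)` for all large `d`, so that the associated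
graded algebra, and with it the algebra itself, is finitely generated.
-/

/-! ### Star-closed graded subalgebras of a matrix algebra -/

namespace Matrix

variable {ι : Type*} [Fintype ι]

theorem IsHermitian.mulVec_eq_zero_of_pow [DecidableEq ι] {p : Matrix ι ι ℂ}
    (hp : p.IsHermitian) {k : ℕ} {v : ι → ℂ} (h : (p ^ k) *ᵥ v = 0) : p *ᵥ v = 0 := by
  induction k with
  | zero => simp_all
  | succ k ih =>
    rcases k with _ | k
    · simpa using h
    · refine ih ?_
      have h2 : (pᴴ * p) *ᵥ ((p ^ k) *ᵥ v) = 0 := by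
        rw [hp.eq, mulVec_mulVec, ← pow_two, ← pow_add, add_comm 2 k]; exact h
      rw [conjTranspose_mul_self_mulVec_eq_zero, mulVec_mulVec, ← pow_succ'] at h2
      exact h2

theorem PosSemidef.mulVec_eq_zero_of_add {p q : Matrix ι ι ℂ} (hp : p.PosSemidef)
    (hq : q.PosSemidef) {v : ι → ℂ} (h : (p + q) *ᵥ v = 0) : p *ᵥ v = 0 ∧ q *ᵥ v = 0 := by
  have h1 := ((hp.add hq).dotProduct_mulVec_zero_iff v).2 h
  rw [add_mulVec, dotProduct_add] at h1
  have h2 := (add_eq_zero_iff_of_nonneg (hp.dotProduct_mulVec_nonneg v)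
    (hq.dotProduct_mulVec_nonneg v)).1 h1
  exact ⟨(hp.dotProduct_mulVec_zero_iff v).1 h2.1, (hq.dotProduct_mulVec_zero_iff v).1 h2.2⟩

end Matrix

/-- A sequence `V 0, V 1, …` of spaces of matrices is a *graded star family* if `⨁ V d tᵈ` is a
subalgebra of `M_ι(ℂ)[t]` stable under the involution `a tᵈ ↦ aᴴ tᵈ`. -/
structure IsGradedStarFamily {ι : Type*} [Fintype ι] [DecidableEq ι]
    (V : ℕ → Submodule ℂ (Matrix ι ι ℂ)) : Prop where
  one_mem : 1 ∈ V 0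
  mul_mem : ∀ {d e a b}, a ∈ V d → b ∈ V e → a * b ∈ V (d + e)
  star_mem : ∀ {d a}, a ∈ V d → aᴴ ∈ V d

namespace IsGradedStarFamily

variable {ι : Type*} [Fintype ι] [DecidableEq ι] {V : ℕ → Submodule ℂ (Matrix ι ι ℂ)}

theorem pow_mem (hV : IsGradedStarFamily V) {d : ℕ} {a : Matrix ι ι ℂ} (ha : a ∈ V d) (k : ℕ) :
    a ^ k ∈ V (d * k) := by
  induction k with
  | zero => simpa using hV.one_mem
  | succ k ih => simpa [pow_succ, Nat.mul_succ] using hV.mul_mem ih ha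

/-- A positive semidefinite element of positive degree with the smallest possible kernel is a
nonzerodivisor on all components of positive degree: for `b ∈ V d`, the element
`p ^ (2 d) + (b bᴴ) ^ m` is again positive semidefinite and homogeneous, so minimality forces
`ker p ⊆ ker (b bᴴ)`. -/
theorem exists_regular (hV : IsGradedStarFamily V) :
    ∃ m, 0 < m ∧ ∃ p ∈ V m, ∀ d, 0 < d → ∀ b ∈ V d, p * b = 0 → b = 0 := by
  let S : Set (Submodule ℂ (ι → ℂ)) :=
    {K | ∃ m, 0 < m ∧ ∃ p ∈ V m, p.PosSemidef ∧ K = LinearMap.ker (Matrix.toLin' p)}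
  have hS : S.Nonempty := ⟨_, 1, one_pos, 0, zero_mem _, Matrix.PosSemidef.zero, rfl⟩
  obtain ⟨K, ⟨m, hm, p, hpV, hp, rfl⟩, hmin⟩ := wellFounded_lt.has_min S hS
  refine ⟨m, hm, p, hpV, fun d hd b hb hpb => ?_⟩
  set q := b * bᴴ with hq
  have hqp : q.PosSemidef := Matrix.posSemidef_self_mul_conjTranspose b
  have hqV : q ∈ V (d + d) := hV.mul_mem hb (hV.star_mem hb)
  have hrV : p ^ (2 * d) + q ^ m ∈ V (m * (2 * d)) := by
    refine add_mem (hV.pow_mem hpV _) ?_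
    have := hV.pow_mem hqV m
    rwa [← two_mul, mul_comm] at this
  have hker : ∀ v, (p ^ (2 * d) + q ^ m) *ᵥ v = 0 → p *ᵥ v = 0 ∧ q *ᵥ v = 0 := fun v hv =>
    have h := (hp.pow _).mulVec_eq_zero_of_add (hqp.pow _) hv
    ⟨hp.1.mulVec_eq_zero_of_pow h.1, hqp.1.mulVec_eq_zero_of_pow h.2⟩
  have hle : LinearMap.ker (Matrix.toLin' (p ^ (2 * d) + q ^ m)) ≤
      LinearMap.ker (Matrix.toLin' p) := fun v hv => by
    simp only [LinearMap.mem_ker, Matrix.toLin'_apply] at hv ⊢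
    exact (hker v hv).1
  have heq := eq_of_le_of_not_lt hle
    (hmin _ ⟨_, by positivity, _, hrV, (hp.pow _).add (hqp.pow _), rfl⟩)
  have hqb : q * b = 0 := by
    refine Matrix.toLin'.injective (LinearMap.ext fun v => ?_)
    have hv : b *ᵥ v ∈ LinearMap.ker (Matrix.toLin' p) := by simp [hpb]
    rw [← heq, LinearMap.mem_ker, Matrix.toLin'_apply] at hv
    simpa using (hker _ hv).2
  rw [hq, Matrix.self_mul_conjTranspose_mul_eq_zero, Matrix.conjTranspose_mul_self_eq_zero] at hqb
  exact hqb

/-- Far out, the components are obtained from one another by multiplication with a single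
homogeneous element: left multiplication by a regular element is injective, and the dimensions are
bounded. -/
theorem exists_eventually_eq_mul (hV : IsGradedStarFamily V) :
    ∃ m, 0 < m ∧ ∃ p ∈ V m, ∃ d₀, ∀ d, d₀ ≤ d → ∀ y ∈ V (d + m), ∃ x ∈ V d, y = p * x := by
  obtain ⟨m, hm, p, hpV, hreg⟩ := hV.exists_regular
  refine ⟨m, hm, p, hpV, ?_⟩
  let f := LinearMap.mulLeft ℂ p
  have hmap (d) : (V d).map f ≤ V (d + m) := by
    rintro _ ⟨x, hx, rfl⟩
    rw [add_comm]
    exact hV.mul_mem hpV hx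
  have hrank (d) (hd : 0 < d) :
      Module.finrank ℂ ((V d).map f) = Module.finrank ℂ (V d) := by
    have hinj : Function.Injective (f.domRestrict (V d)) := by
      rw [← LinearMap.ker_eq_bot, LinearMap.ker_eq_bot']
      rintro ⟨x, hx⟩ h
      exact Subtype.ext (hreg d hd x hx h)
    rw [← LinearMap.range_domRestrict]
    exact LinearMap.finrank_range_of_inj hinj
  -- The sum of `m` consecutive dimensions is nondecreasing and bounded, hence stabilizes. The
  -- degree `0` is left out, as `p` need not be regular on `V 0`.
  let g : ℕ → ℕ := fun d => Module.finrank ℂ (V d)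
  let G : ℕ → ℕ := fun d => ∑ i ∈ Finset.range m, g (d + 1 + i)
  have hG (d) : G (d + 1) + g (d + 1) = G d + g (d + 1 + m) := by
    rw [← Finset.sum_range_succ (fun i => g (d + 1 + i)) m, Finset.sum_range_succ']
    simp only [G, add_zero, add_assoc, add_comm 1]
  have hstep (d) : g (d + 1) ≤ g (d + 1 + m) := by
    simp only [g]
    rw [← hrank (d + 1) (Nat.succ_pos _)]
    exact Submodule.finrank_mono (hmap _)
  have hmono : Monotone G := monotone_nat_of_le_succ fun d => by
    have := hG d
    have := hstep d
    omega
  have hbdd (d) : G d ≤ m * Module.finrank ℂ (Matrix ι ι ℂ) := by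
    refine (Finset.sum_le_card_nsmul _ _ _ fun i _ => Submodule.finrank_le (V (d + 1 + i))).trans ?_
    simp
  obtain ⟨_, ⟨d₀, rfl⟩, hmax⟩ := Set.Finite.exists_maximal
    ((Set.finite_Iic _).subset (Set.range_subset_iff.2 hbdd)) (Set.range_nonempty G)
  have hconst (d) (hd : d₀ ≤ d) : G d = G d₀ :=
    le_antisymm (hmax ⟨d, rfl⟩ (hmono hd)) (hmono hd)
  refine ⟨d₀ + 1, fun d hd y hy => ?_⟩
  obtain ⟨e, rfl⟩ : ∃ e, d = e + 1 := ⟨d - 1, by omega⟩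
  have h1 := hG e
  rw [hconst e (by omega), hconst (e + 1) (by omega)] at h1
  have h2 : (V (e + 1)).map f = V (e + 1 + m) :=
    Submodule.eq_of_le_of_finrank_eq (hmap _) (by
      rw [hrank (e + 1) (Nat.succ_pos _)]
      exact (Nat.add_left_cancel h1 :))
  rw [← h2] at hy
  obtain ⟨x, hx, rfl⟩ := hy
  exact ⟨x, hx, rfl⟩

end IsGradedStarFamily

/-! ### Lifting generators from symbols -/

/-- `R d` relates an element of filtration degree at most `d` to its symbol of degree `d`. If the
symbols form a graded star family, and an element whose symbol of degree `d` vanishes has lower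
degree, then the algebra is finitely generated. -/
theorem Algebra.FiniteType.of_symbols {A ι : Type*} [Ring A] [Algebra ℂ A] [Fintype ι]
    [DecidableEq ι] (R : ℕ → Submodule ℂ (A × Matrix ι ι ℂ))
    (hone : (1, 1) ∈ R 0)
    (hmul : ∀ {d e x y}, x ∈ R d → y ∈ R e → x * y ∈ R (d + e))
    (hstar : ∀ {d a v}, (a, v) ∈ R d → ∃ a', (a', vᴴ) ∈ R d)
    (hex : ∀ a, ∃ d v, (a, v) ∈ R d)
    (hzero : ∀ a, (a, 0) ∈ R 0 → a = 0)
    (hsucc : ∀ d a, (a, 0) ∈ R (d + 1) → ∃ v, (a, v) ∈ R d) :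
    Algebra.FiniteType ℂ A := by
  let V : ℕ → Submodule ℂ (Matrix ι ι ℂ) := fun d => (R d).map (LinearMap.snd ℂ A _)
  have hVmem {d v} : v ∈ V d ↔ ∃ a, (a, v) ∈ R d := by simp [V]
  have hV : IsGradedStarFamily V :=
    { one_mem := hVmem.2 ⟨1, hone⟩
      mul_mem := fun ha hb => by
        obtain ⟨a, ha⟩ := hVmem.1 ha
        obtain ⟨b, hb⟩ := hVmem.1 hb
        exact hVmem.2 ⟨a * b, hmul ha hb⟩
      star_mem := fun ha => by
        obtain ⟨a, ha⟩ := hVmem.1 ha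
        exact hVmem.2 (hstar ha) }
  obtain ⟨m, hm, p, hp, d₀, hd₀⟩ := hV.exists_eventually_eq_mul
  obtain ⟨a, ha⟩ := hVmem.1 hp
  have hbasis (d) : ∃ s : Finset A, ∀ v ∈ V d,
      ∃ b ∈ Submodule.span ℂ (s : Set A), (b, v) ∈ R d := by
    obtain ⟨t, ht⟩ := (IsNoetherian.noetherian (V d) : (V d).FG)
    have hlift (v : Matrix ι ι ℂ) : ∃ b : A, v ∈ t → (b, v) ∈ R d := by
      by_cases hv : v ∈ t
      · obtain ⟨b, hb⟩ := hVmem.1 (ht ▸ Submodule.subset_span hv : v ∈ V d)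
        exact ⟨b, fun _ => hb⟩
      · exact ⟨0, fun h => absurd h hv⟩
    choose g hg using hlift
    classical
    refine ⟨t.image g, fun v hv => ?_⟩
    rw [← ht] at hv
    induction hv using Submodule.span_induction with
    | mem v hv =>
      exact ⟨g v, Submodule.subset_span (by simpa using ⟨v, hv, rfl⟩), hg v hv⟩
    | zero => exact ⟨0, zero_mem _, zero_mem _⟩
    | add v w _ _ h1 h2 =>
      obtain ⟨b, hb, hb'⟩ := h1
      obtain ⟨c, hc, hc'⟩ := h2
      exact ⟨b + c, add_mem hb hc, add_mem hb' hc'⟩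
    | smul r v _ h1 =>
      obtain ⟨b, hb, hb'⟩ := h1
      exact ⟨r • b, Submodule.smul_mem _ r hb, Submodule.smul_mem _ r hb'⟩
  choose s hs using hbasis
  classical
  let T : Finset A := insert a ((Finset.range (d₀ + m)).biUnion s)
  let B := Algebra.adjoin ℂ (T : Set A)
  -- Every symbol is the symbol of an element of `B`.
  have hsymb (d) : ∀ v ∈ V d, ∃ b ∈ B, (b, v) ∈ R d := by
    induction d using Nat.strong_induction_on with
    | _ d ih =>
      intro v hv
      by_cases hd : d < d₀ + m
      · obtain ⟨b, hb, hb'⟩ := hs d v hv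
        refine ⟨b, ?_, hb'⟩
        have hsub : (s d : Set A) ⊆ (Subalgebra.toSubmodule B : Set A) := fun x hx =>
          Algebra.subset_adjoin (by
            simp only [T, Finset.coe_insert, Finset.coe_biUnion]
            exact Or.inr (Set.mem_biUnion (by simpa using hd) hx))
        exact Submodule.span_le.2 hsub hb
      · obtain ⟨e, rfl⟩ : ∃ e, d = e + m := ⟨d - m, by omega⟩
        obtain ⟨x, hx, rfl⟩ := hd₀ e (by omega) v hv
        obtain ⟨b, hb, hb'⟩ := ih e (by omega) x hx
        refine ⟨a * b, mul_mem (Algebra.subset_adjoin (by simp [T])) hb, ?_⟩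
        rw [add_comm]
        exact hmul ha hb'
  have htop (d) : ∀ x v, (x, v) ∈ R d → x ∈ B := by
    induction d with
    | zero =>
      intro x v hx
      obtain ⟨b, hb, hb'⟩ := hsymb 0 v (hVmem.2 ⟨x, hx⟩)
      have h0 : (x - b, 0) ∈ R 0 := by simpa using sub_mem hx hb'
      rwa [sub_eq_zero.1 (hzero _ h0)]
    | succ d ih =>
      intro x v hx
      obtain ⟨b, hb, hb'⟩ := hsymb (d + 1) v (hVmem.2 ⟨x, hx⟩)
      have h0 : (x - b, 0) ∈ R (d + 1) := by simpa using sub_mem hx hb'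
      obtain ⟨w, hw⟩ := hsucc d _ h0
      simpa using add_mem (ih _ w hw) hb
  refine ⟨⟨T, ?_⟩⟩
  refine Algebra.eq_top_iff.2 fun x => ?_
  obtain ⟨d, v, hx⟩ := hex x
  exact htop d x v hx

/-! ### Symbols at infinity -/

section Symbols

open Filter Topology

theorem Polynomial.natDegree_le_and_coeff_eq_of_tendsto (f : ℝ[X]) (d : ℕ) (c : ℝ)
    (h : Tendsto (fun n : ℕ => f.eval (n : ℝ) / (n : ℝ) ^ d) (hyperfilter ℕ) (𝓝 c)) :
    f.natDegree ≤ d ∧ f.coeff d = c := by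
  have hω : Tendsto (fun n : ℕ => (n : ℝ)) (hyperfilter ℕ) atTop :=
    tendsto_natCast_atTop_atTop.mono_left Nat.hyperfilter_le_atTop
  have hd : f.natDegree ≤ d := by
    by_contra! hlt
    have hf : f ≠ 0 := by rintro rfl; simp at hlt
    have h1 := (Polynomial.abs_div_tendsto_atTop_atTop_of_degree_gt f (X ^ d) (by
      rw [degree_X_pow, degree_eq_natDegree hf]; exact_mod_cast hlt) (by simp)).comp hω
    refine not_tendsto_nhds_of_tendsto_atTop h1 |c| ?_
    simpa [Function.comp_def] using h.abs
  refine ⟨hd, ?_⟩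
  have h2 : Tendsto (fun x => f.eval x / (X ^ d : ℝ[X]).eval x) atTop (𝓝 (f.coeff d)) := by
    rcases eq_or_lt_of_le hd with rfl | hlt
    · by_cases hf : f = 0
      · simp [hf]
      · simpa using Polynomial.div_tendsto_atTop_leadingCoeff_div_of_degree_eq f (X ^ f.natDegree)
          (by rw [degree_X_pow, degree_eq_natDegree hf])
    · rw [coeff_eq_zero_of_natDegree_lt hlt]
      exact Polynomial.div_tendsto_atTop_zero_of_degree_lt f (X ^ d) (by
        rw [degree_X_pow]
        exact degree_le_natDegree.trans_lt (by exact_mod_cast hlt))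
  exact tendsto_nhds_unique (by simpa [Function.comp_def] using h2.comp hω) h

theorem Polynomial.exists_abs_eval_div_le (f : ℝ[X]) {d : ℕ} (hd : f.natDegree ≤ d) :
    ∃ C, ∀ n : ℕ, 0 < n → |f.eval (n : ℝ) / (n : ℝ) ^ d| ≤ C := by
  refine ⟨∑ i ∈ Finset.range (d + 1), |f.coeff i|, fun n hn => ?_⟩
  have hn1 : (1 : ℝ) ≤ n := by exact_mod_cast hn
  rw [abs_div, abs_of_nonneg (by positivity : (0 : ℝ) ≤ (n : ℝ) ^ d), div_le_iff₀ (by positivity),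
    eval_eq_sum_range' (Nat.lt_succ_of_le hd), Finset.sum_mul]
  refine (Finset.abs_sum_le_sum_abs _ _).trans (Finset.sum_le_sum fun i hi => ?_)
  rw [abs_mul, abs_of_nonneg (by positivity : (0 : ℝ) ≤ (n : ℝ) ^ i)]
  gcongr
  exact Nat.lt_succ_iff.1 (Finset.mem_range.1 hi)

theorem Matrix.re_trace_mul_conjTranspose_self {ι : Type*} [Fintype ι] (M : Matrix ι ι ℂ) :
    (M * Mᴴ).trace.re = ∑ i, ∑ j, ‖M i j‖ ^ 2 := by
  simp [Matrix.trace, Matrix.mul_apply, Complex.mul_conj, Complex.normSq_eq_norm_sq,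
    -Complex.ofReal_pow]

theorem Matrix.norm_sq_apply_le_re_trace {ι : Type*} [Fintype ι] (M : Matrix ι ι ℂ) (i j : ι) :
    ‖M i j‖ ^ 2 ≤ (M * Mᴴ).trace.re := by
  rw [M.re_trace_mul_conjTranspose_self]
  exact (Finset.single_le_sum (f := fun j => ‖M i j‖ ^ 2) (fun _ _ => by positivity)
    (Finset.mem_univ j)).trans (Finset.single_le_sum (f := fun i => ∑ j, ‖M i j‖ ^ 2)
      (fun _ _ => by positivity) (Finset.mem_univ i))

theorem Matrix.eq_zero_of_re_trace_mul_conjTranspose_self {ι : Type*} [Fintype ι]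
    {M : Matrix ι ι ℂ} (h : (M * Mᴴ).trace.re = 0) : M = 0 := by
  ext i j
  have := M.norm_sq_apply_le_re_trace i j
  rw [h] at this
  simpa using pow_eq_zero_iff (two_ne_zero) |>.1 (le_antisymm this (by positivity))

/-- The normalization factor `n ^ (-1 / 2)`, as a complex number (with value `0` at `n = 0`). -/
noncomputable def invSqrt (n : ℕ) : ℂ := ((√(n : ℝ))⁻¹ : ℝ)

theorem invSqrt_pow_mul_star (n d : ℕ) :
    invSqrt n ^ d * star (invSqrt n ^ d) = (((n : ℝ) ^ d)⁻¹ : ℝ) := by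
  rw [star_pow, ← mul_pow]
  simp only [invSqrt, Complex.star_def, Complex.conj_ofReal]
  rw [← Complex.ofReal_mul, ← mul_inv, Real.mul_self_sqrt (Nat.cast_nonneg n)]
  push_cast
  rw [inv_pow]

theorem re_trace_smul_invSqrt {ι : Type*} [Fintype ι] (d n : ℕ) (M : Matrix ι ι ℂ) :
    ((invSqrt n ^ d • M) * (invSqrt n ^ d • M)ᴴ).trace.re = (M * Mᴴ).trace.re / (n : ℝ) ^ d := by
  rw [Matrix.conjTranspose_smul, Matrix.smul_mul, Matrix.mul_smul, smul_smul,
    invSqrt_pow_mul_star, Matrix.trace_smul, smul_eq_mul, Complex.re_ofReal_mul, div_eq_inv_mul]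

variable {A ι : Type*} [Ring A] [Algebra ℂ A] [Fintype ι] [DecidableEq ι]

/-- The pairs `(a, v)` such that `n ^ (-d / 2) φ(a)(n)` converges to `v` along a fixed
nonprincipal ultrafilter on `ℕ`. -/
noncomputable def symbolRel (φ : A →ₐ[ℂ] (ℕ → Matrix ι ι ℂ)) (d : ℕ) :
    Submodule ℂ (A × Matrix ι ι ℂ) where
  carrier := {x | Tendsto (fun n => invSqrt n ^ d • φ x.1 n) (hyperfilter ℕ) (𝓝 x.2)}
  zero_mem' := by simp
  add_mem' {x y} hx hy := by
    simpa [smul_add] using Tendsto.add hx hy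
  smul_mem' c x hx := by
    simpa [smul_comm _ c] using Tendsto.const_smul hx c

variable {φ : A →ₐ[ℂ] (ℕ → Matrix ι ι ℂ)}

theorem mem_symbolRel {d : ℕ} {a : A} {v : Matrix ι ι ℂ} : (a, v) ∈ symbolRel φ d ↔
    Tendsto (fun n => invSqrt n ^ d • φ a n) (hyperfilter ℕ) (𝓝 v) := Iff.rfl

/-- If `a` has a symbol of degree `d`, then its squared Hilbert–Schmidt norm is a polynomial of
degree at most `d`, whose coefficient of degree `d` is the squared norm of the symbol. -/
theorem natDegree_le_of_mem_symbolRel {d : ℕ} {a : A} {v : Matrix ι ι ℂ} {f : ℝ[X]}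
    (hf : ∀ n : ℕ, (φ a n * (φ a n)ᴴ).trace.re = f.eval (n : ℝ)) (h : (a, v) ∈ symbolRel φ d) :
    f.natDegree ≤ d ∧ f.coeff d = (v * vᴴ).trace.re := by
  apply Polynomial.natDegree_le_and_coeff_eq_of_tendsto
  have hc : Continuous fun M : Matrix ι ι ℂ => (M * Mᴴ).trace.re := by
    have : Continuous fun M : Matrix ι ι ℂ => (M * Mᴴ).trace := by fun_prop
    exact Complex.continuous_re.comp this
  have := (hc.tendsto v).comp (mem_symbolRel.1 h)
  simpa only [Function.comp_def, re_trace_smul_invSqrt, hf] using this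

/-- Conversely, if the squared Hilbert–Schmidt norm of `a` has degree at most `d`, then `a` has a
symbol of degree `d`, by compactness. -/
theorem exists_mem_symbolRel {d : ℕ} {a : A} {f : ℝ[X]}
    (hf : ∀ n : ℕ, (φ a n * (φ a n)ᴴ).trace.re = f.eval (n : ℝ)) (hd : f.natDegree ≤ d) :
    ∃ v, (a, v) ∈ symbolRel φ d := by
  obtain ⟨C, hC⟩ := f.exists_abs_eval_div_le hd
  have hent (i j) : ∃ c : ℂ,
      Tendsto (fun n => (invSqrt n ^ d • φ a n) i j) (hyperfilter ℕ) (𝓝 c) := by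
    have hb : ∀ᶠ n in (hyperfilter ℕ : Filter ℕ),
        (invSqrt n ^ d • φ a n) i j ∈ Metric.closedBall (0 : ℂ) (√C) := by
      refine Nat.hyperfilter_le_atTop ?_
      filter_upwards [eventually_gt_atTop 0] with n hn
      rw [mem_closedBall_zero_iff]
      refine Real.le_sqrt_of_sq_le ?_
      refine (Matrix.norm_sq_apply_le_re_trace _ i j).trans ?_
      rw [re_trace_smul_invSqrt, hf]
      exact (le_abs_self _).trans (hC n hn)
    obtain ⟨c, -, hc⟩ := (isCompact_closedBall (0 : ℂ) (√C)).ultrafilter_le_nhds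
      ((hyperfilter ℕ).map fun n => (invSqrt n ^ d • φ a n) i j)
      (le_principal_iff.2 hb)
    exact ⟨c, hc⟩
  choose v hv using hent
  exact ⟨Matrix.of v, tendsto_pi_nhds.2 fun i => tendsto_pi_nhds.2 fun j => hv i j⟩

/-- An algebra of sequences of complex matrices which is stable under the pointwise conjugate
transpose, and on which the traces are polynomial, is finitely generated. -/
theorem Algebra.FiniteType.of_star_closed_of_polynomial_trace
    (φ : A →ₐ[ℂ] (ℕ → Matrix ι ι ℂ)) (hinj : Function.Injective φ)
    (hstar : ∀ a, ∃ a', ∀ n, φ a' n = (φ a n)ᴴ)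
    (htrace : ∀ a, ∃ f : ℂ[X], ∀ n : ℕ, (φ a n).trace = f.eval (n : ℂ)) :
    Algebra.FiniteType ℂ A := by
  have hnorm (a) : ∃ f : ℝ[X], ∀ n : ℕ, (φ a n * (φ a n)ᴴ).trace.re = f.eval (n : ℝ) := by
    obtain ⟨a', ha'⟩ := hstar a
    obtain ⟨f, hf⟩ := htrace (a * a')
    refine ⟨∑ i ∈ Finset.range (f.natDegree + 1), Polynomial.monomial i (f.coeff i).re,
      fun n => ?_⟩
    have h := hf n
    rw [map_mul, Pi.mul_apply, ha'] at h
    rw [h, Polynomial.eval_eq_sum_range, Polynomial.eval_finsetSum, Complex.re_sum]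
    refine Finset.sum_congr rfl fun i _ => ?_
    rw [Polynomial.eval_monomial, ← Complex.ofReal_natCast, ← Complex.ofReal_pow,
      Complex.re_mul_ofReal]
  refine Algebra.FiniteType.of_symbols (symbolRel φ) ?_ ?_ ?_ ?_ ?_ ?_
  · simp [mem_symbolRel]
  · intro d e x y hx hy
    have := Tendsto.mul (mem_symbolRel.1 hx) (mem_symbolRel.1 hy)
    refine mem_symbolRel.2 (this.congr fun n => ?_)
    rw [Matrix.smul_mul, Matrix.mul_smul, smul_smul, pow_add, map_mul, Pi.mul_apply]
  · intro d a v h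
    obtain ⟨a', ha'⟩ := hstar a
    refine ⟨a', mem_symbolRel.2 ?_⟩
    refine ((continuous_id.matrix_conjTranspose.tendsto v).comp (mem_symbolRel.1 h)).congr
      fun n => ?_
    simp [ha', Matrix.conjTranspose_smul, invSqrt]
  · intro a
    obtain ⟨f, hf⟩ := hnorm a
    exact ⟨f.natDegree, exists_mem_symbolRel hf le_rfl⟩
  · intro a h
    obtain ⟨f, hf⟩ := hnorm a
    have hd := natDegree_le_of_mem_symbolRel hf h
    have hf0 : f = 0 := by
      rw [Polynomial.eq_C_of_natDegree_le_zero hd.1, hd.2]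
      simp
    refine hinj (funext fun n => ?_)
    rw [map_zero]
    exact Matrix.eq_zero_of_re_trace_mul_conjTranspose_self (by rw [hf, hf0]; simp)
  · intro d a h
    obtain ⟨f, hf⟩ := hnorm a
    have hd := natDegree_le_of_mem_symbolRel hf h
    refine exists_mem_symbolRel hf ?_
    have h0 : f.coeff (d + 1) = 0 := by simpa using hd.2
    by_contra! hlt
    have he : f.natDegree = d + 1 := by omega
    rw [← he] at h0
    have : f = 0 := Polynomial.leadingCoeff_eq_zero.1 h0
    simp [this] at he

end Symbols

/-! ### Matrix polynomials -/

namespace MatPoly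

variable {N : ℕ}

theorem coeffMat_add (F G : MatPoly N) (k : ℕ) :
    coeffMat (F + G) k = coeffMat F k + coeffMat G k := by
  ext; simp [coeffMat]

theorem coeffMat_sub (F G : MatPoly N) (k : ℕ) :
    coeffMat (F - G) k = coeffMat F k - coeffMat G k := by
  ext; simp [coeffMat]

theorem coeffMat_sum {α : Type*} (s : Finset α) (F : α → MatPoly N) (k : ℕ) :
    coeffMat (∑ i ∈ s, F i) k = ∑ i ∈ s, coeffMat (F i) k := by
  ext; simp [coeffMat, Matrix.sum_apply]

theorem coeffMat_const_mul (L : Matrix (Fin N) (Fin N) ℂ) (F : MatPoly N) (k : ℕ) :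
    coeffMat (const L * F) k = L * coeffMat F k := by
  ext; simp [coeffMat, const, Matrix.mul_apply]

theorem coeffMat_X_pow_smul_one (n k : ℕ) :
    coeffMat ((Polynomial.X : ℂ[X]) ^ n • (1 : MatPoly N)) k = if k = n then 1 else 0 := by
  ext i j
  by_cases hij : i = j <;> by_cases hk : k = n <;>
    simp [coeffMat, Matrix.one_apply, hij, hk, Polynomial.coeff_X_pow]

theorem const_mul (L M : Matrix (Fin N) (Fin N) ℂ) : const (L * M) = const L * const M :=
  Matrix.map_mul

theorem const_smul_one (r : ℂ) (F : MatPoly N) :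
    const (r • (1 : Matrix (Fin N) (Fin N) ℂ)) * F = r • F := by
  ext i j : 2
  simp [const, Matrix.mul_apply, Matrix.one_apply, Polynomial.smul_eq_C_mul, apply_ite]

theorem exists_degree_bound (F : MatPoly N) : ∃ d, ∀ k, d ≤ k → coeffMat F k = 0 := by
  refine ⟨∑ i, ∑ j, ((F i j).natDegree + 1), fun k hk => ?_⟩
  ext i j
  refine Polynomial.coeff_eq_zero_of_natDegree_lt (lt_of_lt_of_le (Nat.lt_succ_self _) ?_)
  exact ((Finset.single_le_sum (f := fun j => (F i j).natDegree + 1) (fun _ _ => Nat.zero_le _)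
    (Finset.mem_univ j)).trans (Finset.single_le_sum
      (f := fun i => ∑ j, ((F i j).natDegree + 1)) (fun _ _ => Nat.zero_le _)
      (Finset.mem_univ i))).trans hk

theorem ext_coeffMat {F G : MatPoly N} (h : ∀ k, coeffMat F k = coeffMat G k) : F = G := by
  ext i j k
  exact congrFun (congrFun (h k) i) j

theorem eq_sum_coeffMat {F : MatPoly N} {d : ℕ} (hd : ∀ k, d ≤ k → coeffMat F k = 0) :
    F = ∑ k ∈ Finset.range d, const (coeffMat F k) * ((Polynomial.X : ℂ[X]) ^ k • 1) := by
  refine ext_coeffMat fun k => ?_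
  simp only [coeffMat_sum, coeffMat_const_mul, coeffMat_X_pow_smul_one, mul_ite, mul_one, mul_zero,
    Finset.sum_ite_eq, Finset.mem_range]
  split_ifs with h
  · rfl
  · exact hd k (not_lt.1 h)

/-- Matrix polynomials are left combinations of any sequence of monic matrix polynomials of degrees
`0, 1, 2, …`. -/
theorem exists_eq_sum_of_monic {P : ℕ → MatPoly N} (hP : ∀ n, (P n).coeffMat n = 1)
    (hdeg : ∀ n k, n < k → (P n).coeffMat k = 0) (d : ℕ) :
    ∀ F : MatPoly N, (∀ k, d ≤ k → coeffMat F k = 0) →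
      ∃ c : ℕ → Matrix (Fin N) (Fin N) ℂ, F = ∑ k ∈ Finset.range d, const (c k) * P k := by
  induction d with
  | zero =>
    exact fun F hF => ⟨0, ext_coeffMat fun k => by rw [hF k k.zero_le]; ext; simp [coeffMat]⟩
  | succ d ih =>
    intro F hF
    obtain ⟨c, hc⟩ := ih (F - const (coeffMat F d) * P d) fun k hk => by
      rw [coeffMat_sub, coeffMat_const_mul]
      rcases hk.eq_or_lt with rfl | hk
      · simp [hP]
      · rw [hF k hk, hdeg d k hk, mul_zero, sub_zero]
    refine ⟨Function.update c d (coeffMat F d), ?_⟩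
    rw [Finset.sum_range_succ, Function.update_self, ← sub_eq_iff_eq_add, hc]
    refine Finset.sum_congr rfl fun k hk => ?_
    rw [Function.update_of_ne (Finset.mem_range.1 hk).ne]

theorem deriv_X_smul (F : MatPoly N) :
    deriv ((Polynomial.X : ℂ[X]) • F) = (Polynomial.X : ℂ[X]) • deriv F + F := by
  ext i j : 2
  simp [deriv, add_comm]

theorem deriv_pow_X_smul (j : ℕ) (F : MatPoly N) :
    (deriv ^ (j + 1)) ((Polynomial.X : ℂ[X]) • F) =
      (Polynomial.X : ℂ[X]) • (deriv ^ (j + 1)) F + ((j : ℂ) + 1) • (deriv ^ j) F := by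
  induction j with
  | zero => simp [deriv_X_smul]
  | succ j ih =>
    rw [pow_succ', Module.End.mul_apply, ih, map_add, deriv_X_smul, LinearMap.map_smul,
      ← Module.End.mul_apply, ← pow_succ', ← Module.End.mul_apply deriv (deriv ^ j), ← pow_succ']
    rw [Nat.cast_succ, add_smul ((j : ℂ) + 1), one_smul, add_assoc, add_comm ((deriv ^ (j + 1)) F)]

/-! ### Differential operators and iterated commutators with `x` -/

/-- Multiplication by `x`. -/
noncomputable def mulX : Module.End ℂ (MatPoly N) :=
  DistribSMul.toLinearMap ℂ (MatPoly N) (Polynomial.X : ℂ[X])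

/-- The commutator `E ↦ x E - E x` with multiplication by `x`. -/
noncomputable def adX : Module.End ℂ (Module.End ℂ (MatPoly N)) :=
  LinearMap.mulLeft ℂ mulX - LinearMap.mulRight ℂ mulX

theorem adX_apply (E : Module.End ℂ (MatPoly N)) (F : MatPoly N) :
    adX E F = (Polynomial.X : ℂ[X]) • E F - E ((Polynomial.X : ℂ[X]) • F) := rfl

/-- Linearity with respect to multiplication by constant matrices from the left. -/
def IsLeftLinear (E : Module.End ℂ (MatPoly N)) : Prop :=
  ∀ L F, E (const L * F) = const L * E F

theorem IsLeftLinear.sub {E E' : Module.End ℂ (MatPoly N)} (hE : IsLeftLinear E)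
    (hE' : IsLeftLinear E') : IsLeftLinear (E - E') := fun L F => by
  simp [hE L F, hE' L F, mul_sub]

theorem IsLeftLinear.adX {E : Module.End ℂ (MatPoly N)} (hE : IsLeftLinear E) :
    IsLeftLinear (adX E) := fun L F => by
  rw [adX_apply, adX_apply, hE, ← mul_smul_comm _ _ F, hE, mul_sub, mul_smul_comm]

theorem IsLeftLinear.apply_eq_mul {E : Module.End ℂ (MatPoly N)} (hE : IsLeftLinear E)
    (h : MatPoly.adX E = 0) (F : MatPoly N) : E F = F * E 1 := by
  have hX (G) : E ((Polynomial.X : ℂ[X]) • G) = (Polynomial.X : ℂ[X]) • E G := by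
    have := LinearMap.congr_fun h G
    rw [adX_apply, LinearMap.zero_apply, sub_eq_zero] at this
    exact this.symm
  have hXk (k : ℕ) : E ((Polynomial.X : ℂ[X]) ^ k • 1) = (Polynomial.X : ℂ[X]) ^ k • E 1 := by
    induction k with
    | zero => simp
    | succ k ih => rw [pow_succ', mul_smul, hX, ih, mul_smul]
  obtain ⟨d, hd⟩ := F.exists_degree_bound
  conv_lhs => rw [eq_sum_coeffMat hd]
  conv_rhs => rw [eq_sum_coeffMat hd]
  simp only [map_sum, hE _ _, hXk, Finset.sum_mul, mul_assoc, smul_mul_assoc, one_mul]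

end MatPoly

namespace MatDiffOp

open MatPoly

variable {N : ℕ}

/-- The operator `F ↦ F · 𝔇` as a linear map. -/
noncomputable def actEnd (A : ℕ →₀ MatPoly N) : Module.End ℂ (MatPoly N) :=
  A.sum fun j a => LinearMap.mulRight ℂ a * MatPoly.deriv ^ j

theorem actEnd_apply (A : ℕ →₀ MatPoly N) (F : MatPoly N) : actEnd A F = act A F := by
  simp [actEnd, act, Finsupp.sum]

theorem actEnd_zero : actEnd (0 : ℕ →₀ MatPoly N) = 0 := Finsupp.sum_zero_index

theorem actEnd_add (A B : ℕ →₀ MatPoly N) : actEnd (A + B) = actEnd A + actEnd B := by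
  ext1 F; simp [actEnd_apply, act_add]

theorem isLeftLinear_actEnd (A : ℕ →₀ MatPoly N) : IsLeftLinear (actEnd A) := fun L F => by
  simp only [actEnd_apply, act_const_mul]

theorem adX_actEnd_single_zero (a : MatPoly N) : adX (actEnd (Finsupp.single 0 a)) = 0 := by
  ext1 F
  simp [adX_apply, actEnd_apply, act_single]

theorem adX_actEnd_single_succ (j : ℕ) (a : MatPoly N) :
    adX (actEnd (Finsupp.single (j + 1) a)) =
      (-((j : ℂ) + 1)) • actEnd (Finsupp.single j a) := by
  ext1 F
  simp only [adX_apply, LinearMap.smul_apply, actEnd_apply, act_single, deriv_pow_X_smul, add_mul,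
    smul_mul_assoc, sub_add_cancel_left, neg_smul]

theorem adX_pow_actEnd_single (j : ℕ) (a : MatPoly N) :
    (adX ^ (j + 1)) (actEnd (Finsupp.single j a)) = 0 := by
  induction j with
  | zero => simpa using adX_actEnd_single_zero a
  | succ j ih =>
    rw [pow_succ, Module.End.mul_apply, adX_actEnd_single_succ, map_smul, ih, smul_zero]

theorem exists_adX_pow_actEnd_eq_zero (A : ℕ →₀ MatPoly N) : ∃ m, (adX ^ m) (actEnd A) = 0 := by
  induction A using Finsupp.induction_linear with
  | zero => exact ⟨0, by simp [actEnd_zero]⟩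
  | add A B hA hB =>
    obtain ⟨m, hm⟩ := hA
    obtain ⟨k, hk⟩ := hB
    refine ⟨m + k, ?_⟩
    rw [actEnd_add, map_add, add_comm m k, pow_add, Module.End.mul_apply, hm, ← pow_add,
      add_comm k m, pow_add, Module.End.mul_apply, hk, map_zero, map_zero, add_zero]
  | single j a => exact ⟨j + 1, adX_pow_actEnd_single j a⟩

theorem exists_adX_actEnd_eq (A : ℕ →₀ MatPoly N) : ∃ B, adX (actEnd B) = actEnd A := by
  induction A using Finsupp.induction_linear with
  | zero => exact ⟨0, by simp [actEnd_zero]⟩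
  | add A A' hA hA' =>
    obtain ⟨B, hB⟩ := hA
    obtain ⟨B', hB'⟩ := hA'
    exact ⟨B + B', by rw [actEnd_add, map_add, hB, hB', actEnd_add]⟩
  | single j a =>
    refine ⟨Finsupp.single (j + 1) ((-((j : ℂ) + 1))⁻¹ • a), ?_⟩
    have hj : -((j : ℂ) + 1) ≠ 0 := neg_ne_zero.2 (Nat.cast_add_one_ne_zero j)
    ext1 F
    rw [adX_actEnd_single_succ]
    simp only [LinearMap.smul_apply, actEnd_apply, act_single, mul_smul_comm, smul_smul,
      mul_inv_cancel₀ hj, one_smul]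

/-- A left linear operator killed by an iterated commutator with `x` is a differential operator:
commutation with `x` is (up to sign) differentiation with respect to the symbol `∂`, which can be
inverted, and the operators commuting with `x` are the multiplications. -/
theorem exists_eq_actEnd (m : ℕ) :
    ∀ E : Module.End ℂ (MatPoly N), IsLeftLinear E → (adX ^ m) E = 0 → ∃ A, E = actEnd A := by
  induction m with
  | zero => exact fun E _ hm => ⟨0, by simpa [actEnd_zero] using hm⟩
  | succ m ih =>
    intro E hE hm
    rw [pow_succ, Module.End.mul_apply] at hm
    obtain ⟨A, hA⟩ := ih _ hE.adX hm
    obtain ⟨B, hB⟩ := exists_adX_actEnd_eq A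
    have h := (hE.sub (isLeftLinear_actEnd B)).apply_eq_mul (by rw [map_sub, hA, hB, sub_self])
    refine ⟨Finsupp.single 0 ((E - actEnd B) 1) + B, ?_⟩
    rw [actEnd_add, ← sub_eq_iff_eq_add]
    ext1 F
    rw [h, actEnd_apply, act_single, pow_zero, Module.End.one_apply]

theorem mem_matDiffOps_iff {D : (Module.End ℂ (MatPoly N))ᵐᵒᵖ} :
    D ∈ matDiffOps N ↔ IsLeftLinear D.unop ∧ ∃ m, (adX ^ m) D.unop = 0 := by
  constructor
  · rintro ⟨A, hA⟩
    obtain rfl : D = MulOpposite.op (actEnd A) :=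
      MulOpposite.unop_injective (LinearMap.ext fun F => by simp [hA, actEnd_apply])
    exact ⟨isLeftLinear_actEnd A, exists_adX_pow_actEnd_eq_zero A⟩
  · rintro ⟨h, m, hm⟩
    obtain ⟨A, hA⟩ := exists_eq_actEnd m _ h hm
    exact ⟨A, fun F => by rw [hA, actEnd_apply]⟩

end MatDiffOp

/-! ### The matrix valued inner product -/

namespace MatPoly

variable {N : ℕ}

theorem evalAt_add (F G : MatPoly N) (x : ℝ) : (F + G).evalAt x = F.evalAt x + G.evalAt x := by
  ext; simp [evalAt]

theorem evalAt_const_mul (L : Matrix (Fin N) (Fin N) ℂ) (F : MatPoly N) (x : ℝ) :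
    evalAt (const L * F) x = L * F.evalAt x := by
  ext; simp [evalAt, const, Matrix.mul_apply, Polynomial.eval_finsetSum]

theorem evalAt_X_smul (F : MatPoly N) (x : ℝ) :
    ((Polynomial.X : ℂ[X]) • F).evalAt x = (x : ℂ) • F.evalAt x := by
  ext; simp [evalAt]

end MatPoly

namespace WeightMatrix

open MatPoly MeasureTheory

variable {N : ℕ} (W : WeightMatrix N)

theorem isHermitian (x : ℝ) : (W.toFun x).IsHermitian := by
  by_cases h : W.lower < (x : EReal) ∧ (x : EReal) < W.upper
  · exact (W.posDef x h.1 h.2).1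
  · simp [W.eq_zero x h]

theorem posSemidef (x : ℝ) : (W.toFun x).PosSemidef := by
  by_cases h : W.lower < (x : EReal) ∧ (x : EReal) < W.upper
  · exact (W.posDef x h.1 h.2).posSemidef
  · rw [W.eq_zero x h]
    exact Matrix.PosSemidef.zero

theorem integrable_eval_mul (f : ℂ[X]) (i j : Fin N) :
    Integrable fun x : ℝ => f.eval (x : ℂ) * W.toFun x i j := by
  simp only [Polynomial.eval_eq_sum_range, Finset.sum_mul, mul_assoc]
  exact integrable_finsetSum _ fun k _ => (W.moments k i j).const_mul _

theorem integrable_inner (P Q : MatPoly N) (i j : Fin N) :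
    Integrable fun x : ℝ => (P.evalAt x * W.toFun x * (Q.evalAt x)ᴴ) i j := by
  have h : (fun x : ℝ => (P.evalAt x * W.toFun x * (Q.evalAt x)ᴴ) i j) = fun x : ℝ =>
      ∑ l, ∑ k, (P i k * (Q j l).map (starRingEnd ℂ)).eval (x : ℂ) * W.toFun x k l := by
    funext x
    simp only [Matrix.mul_apply, Finset.sum_mul, evalAt, Matrix.map_apply,
      Matrix.conjTranspose_apply, Polynomial.eval_mul]
    refine Finset.sum_congr rfl fun l _ => Finset.sum_congr rfl fun k _ => ?_
    have hx : (x : ℂ) = starRingEnd ℂ (x : ℂ) := (Complex.conj_ofReal x).symm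
    have hq : ((Q j l).map (starRingEnd ℂ)).eval (x : ℂ) = star ((Q j l).eval (x : ℂ)) := by
      conv_lhs => rw [hx, Polynomial.eval_map_apply]
      rfl
    rw [hq]
    ring
  rw [h]
  exact integrable_finsetSum _ fun l _ => integrable_finsetSum _ fun k _ =>
    W.integrable_eval_mul _ k l

theorem innerProduct_add_left (P P' Q : MatPoly N) :
    W.innerProduct (P + P') Q = W.innerProduct P Q + W.innerProduct P' Q := by
  ext i j
  simp only [innerProduct, Matrix.of_apply, Matrix.add_apply]
  rw [← integral_add (W.integrable_inner P Q i j) (W.integrable_inner P' Q i j)]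
  simp only [evalAt_add, add_mul, Matrix.add_apply]

theorem innerProduct_const_mul_left (L : Matrix (Fin N) (Fin N) ℂ) (P Q : MatPoly N) :
    W.innerProduct (const L * P) Q = L * W.innerProduct P Q := by
  ext i j
  simp only [innerProduct, Matrix.of_apply, Matrix.mul_apply (M := L)]
  simp_rw [← integral_const_mul]
  rw [← integral_finsetSum _ fun k _ => (W.integrable_inner P Q k j).const_mul _]
  simp only [evalAt_const_mul, mul_assoc]
  simp only [Matrix.mul_apply (M := L)]

theorem innerProduct_conjTranspose (P Q : MatPoly N) :
    (W.innerProduct P Q)ᴴ = W.innerProduct Q P := by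
  ext i j
  simp only [innerProduct, Matrix.of_apply, Matrix.conjTranspose_apply]
  refine integral_conj.symm.trans (integral_congr_ae (Filter.Eventually.of_forall fun x => ?_))
  have h : (P.evalAt x * W.toFun x * (Q.evalAt x)ᴴ)ᴴ =
      Q.evalAt x * W.toFun x * (P.evalAt x)ᴴ := by
    simp [Matrix.conjTranspose_mul, (W.isHermitian x).eq, mul_assoc]
  exact congrFun (congrFun h i) j

theorem innerProduct_X_smul (P Q : MatPoly N) :
    W.innerProduct ((Polynomial.X : ℂ[X]) • P) Q =
      W.innerProduct P ((Polynomial.X : ℂ[X]) • Q) := by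
  ext i j
  simp [innerProduct, evalAt_X_smul, Matrix.conjTranspose_smul]

/-- The inner product with a fixed second argument. -/
noncomputable def innerLeft (Q : MatPoly N) : MatPoly N →+ Matrix (Fin N) (Fin N) ℂ :=
  AddMonoidHom.mk' (fun P => W.innerProduct P Q) fun P P' => W.innerProduct_add_left P P' Q

theorem innerProduct_sub_left (P P' Q : MatPoly N) :
    W.innerProduct (P - P') Q = W.innerProduct P Q - W.innerProduct P' Q :=
  map_sub (W.innerLeft Q) P P'

theorem innerProduct_sum_left {α : Type*} (s : Finset α) (P : α → MatPoly N) (Q : MatPoly N) :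
    W.innerProduct (∑ i ∈ s, P i) Q = ∑ i ∈ s, W.innerProduct (P i) Q :=
  map_sum (W.innerLeft Q) P s

theorem innerProduct_smul_left (r : ℂ) (P Q : MatPoly N) :
    W.innerProduct (r • P) Q = r • W.innerProduct P Q := by
  rw [← const_smul_one, innerProduct_const_mul_left, smul_mul_assoc, one_mul]

theorem innerProduct_sub_right (P Q Q' : MatPoly N) :
    W.innerProduct P (Q - Q') = W.innerProduct P Q - W.innerProduct P Q' := by
  simp only [← W.innerProduct_conjTranspose _ P, innerProduct_sub_left,
    Matrix.conjTranspose_sub]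

theorem innerProduct_sum_right {α : Type*} (s : Finset α) (P : MatPoly N) (Q : α → MatPoly N) :
    W.innerProduct P (∑ i ∈ s, Q i) = ∑ i ∈ s, W.innerProduct P (Q i) := by
  simp only [← W.innerProduct_conjTranspose _ P, innerProduct_sum_left,
    Matrix.conjTranspose_sum]

theorem innerProduct_const_mul_right (L : Matrix (Fin N) (Fin N) ℂ) (P Q : MatPoly N) :
    W.innerProduct P (const L * Q) = W.innerProduct P Q * Lᴴ := by
  simp only [← W.innerProduct_conjTranspose _ P, innerProduct_const_mul_left,
    Matrix.conjTranspose_mul]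

/-- The quadratic form `v ↦ v* ⟨F, F⟩ v` is the integral of the nonnegative function
`u* W(x) u`, where `u = F(x)* v`. -/
theorem dotProduct_innerProduct_mulVec (F : MatPoly N) (v : Fin N → ℂ) :
    star v ⬝ᵥ (W.innerProduct F F *ᵥ v) =
      ((∫ x : ℝ, (star ((F.evalAt x)ᴴ *ᵥ v) ⬝ᵥ (W.toFun x *ᵥ ((F.evalAt x)ᴴ *ᵥ v))).re : ℝ) : ℂ)
    ∧ Integrable fun x : ℝ =>
      (star ((F.evalAt x)ᴴ *ᵥ v) ⬝ᵥ (W.toFun x *ᵥ ((F.evalAt x)ᴴ *ᵥ v))).re := by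
  have hq (x : ℝ) : star ((F.evalAt x)ᴴ *ᵥ v) ⬝ᵥ (W.toFun x *ᵥ ((F.evalAt x)ᴴ *ᵥ v)) =
      ∑ i, ∑ j, star (v i) * ((F.evalAt x * W.toFun x * (F.evalAt x)ᴴ) i j * v j) := by
    rw [Matrix.star_mulVec, Matrix.conjTranspose_conjTranspose, ← Matrix.dotProduct_mulVec,
      Matrix.mulVec_mulVec, Matrix.mulVec_mulVec]
    simp [dotProduct, Matrix.mulVec, Finset.mul_sum]
  have hint (i j) : Integrable fun x : ℝ =>
      star (v i) * ((F.evalAt x * W.toFun x * (F.evalAt x)ᴴ) i j * v j) :=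
    ((W.integrable_inner F F i j).mul_const _).const_mul _
  have hI : Integrable fun x : ℝ =>
      star ((F.evalAt x)ᴴ *ᵥ v) ⬝ᵥ (W.toFun x *ᵥ ((F.evalAt x)ᴴ *ᵥ v)) := by
    simp only [hq]
    exact integrable_finsetSum _ fun i _ => integrable_finsetSum _ fun j _ => hint i j
  refine ⟨?_, hI.re⟩
  rw [← integral_complex_ofReal]
  have hre (x : ℝ) : (((star ((F.evalAt x)ᴴ *ᵥ v) ⬝ᵥ
      (W.toFun x *ᵥ ((F.evalAt x)ᴴ *ᵥ v))).re : ℝ) : ℂ) =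
      star ((F.evalAt x)ᴴ *ᵥ v) ⬝ᵥ (W.toFun x *ᵥ ((F.evalAt x)ᴴ *ᵥ v)) :=
    (Complex.eq_re_of_ofReal_le (r := 0) (by
      rw [Complex.ofReal_zero]
      exact (W.posSemidef x).dotProduct_mulVec_nonneg _)).symm
  simp only [hre]
  simp only [hq]
  rw [integral_finsetSum _ fun i _ => integrable_finsetSum _ fun j _ => hint i j]
  simp only [dotProduct, Matrix.mulVec, Finset.mul_sum, Pi.star_apply]
  refine Finset.sum_congr rfl fun i _ => ?_
  rw [integral_finsetSum _ fun j _ => hint i j]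
  refine Finset.sum_congr rfl fun j _ => ?_
  rw [integral_const_mul, integral_mul_const]
  rfl

theorem volume_support_pos :
    0 < volume {x : ℝ | W.lower < (x : EReal) ∧ (x : EReal) < W.upper} := by
  obtain ⟨a, ha, ha'⟩ := EReal.lt_iff_exists_real_btwn.1 W.lower_lt_upper
  obtain ⟨b, hb, hb'⟩ := EReal.lt_iff_exists_real_btwn.1 ha'
  refine lt_of_lt_of_le ?_ (measure_mono (s := Set.Ioo a b) fun x hx =>
    ⟨ha.trans (EReal.coe_lt_coe_iff.2 hx.1), (EReal.coe_lt_coe_iff.2 hx.2).trans hb'⟩)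
  simpa using EReal.coe_lt_coe_iff.1 hb

theorem dotProduct_innerProduct_mulVec_nonneg (F : MatPoly N) (v : Fin N → ℂ) :
    0 ≤ star v ⬝ᵥ (W.innerProduct F F *ᵥ v) := by
  rw [(W.dotProduct_innerProduct_mulVec F v).1, Complex.zero_le_real]
  exact integral_nonneg fun x =>
    (Complex.le_def.1 ((W.posSemidef x).dotProduct_mulVec_nonneg _)).1

/-- A row `v*` with `v* ⟨F, F⟩ v = 0` annihilates `F`: the row of polynomials `v* F(x)` vanishes
almost everywhere on an interval. -/
theorem sum_C_star_mul_eq_zero (F : MatPoly N) (v : Fin N → ℂ)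
    (h : star v ⬝ᵥ (W.innerProduct F F *ᵥ v) = 0) (j : Fin N) :
    ∑ i, Polynomial.C (star (v i)) * F i j = 0 := by
  obtain ⟨h1, hI⟩ := W.dotProduct_innerProduct_mulVec F v
  rw [h, eq_comm, Complex.ofReal_eq_zero, integral_eq_zero_iff_of_nonneg
    (fun x => (Complex.le_def.1 ((W.posSemidef x).dotProduct_mulVec_nonneg _)).1) hI] at h1
  by_contra hne
  have hfin : volume {x : ℝ | (∑ i, Polynomial.C (star (v i)) * F i j).eval (x : ℂ) = 0} = 0 := by
    refine Set.Finite.measure_zero (Set.Finite.of_finite_image (f := ((↑) : ℝ → ℂ))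
      ((Polynomial.finite_setOfPred_isRoot hne).subset ?_) Complex.ofReal_injective.injOn) _
    rintro _ ⟨x, hx, rfl⟩
    exact hx
  refine W.volume_support_pos.ne' (measure_mono_null (fun x hx => ?_) (measure_union_null h1 hfin))
  by_contra hx'
  simp only [Set.mem_union, not_or] at hx'
  obtain ⟨hx1, hx2⟩ := hx'
  refine hx2 ?_
  simp only [Set.mem_compl_iff, Set.mem_ofPred_eq, not_not] at hx1
  have hu : (F.evalAt x)ᴴ *ᵥ v = 0 := by
    by_contra hu
    exact ((Complex.lt_def.1 ((W.posDef x hx.1 hx.2).dotProduct_mulVec_pos hu)).1).ne' hx1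
  have huj := congrArg star (congrFun hu j)
  simpa [Matrix.mulVec, dotProduct, evalAt, Polynomial.eval_finsetSum, mul_comm] using huj

theorem eq_zero_of_innerProduct_self {F : MatPoly N} (h : W.innerProduct F F = 0) : F = 0 := by
  refine Matrix.ext fun i j => ?_
  have := W.sum_C_star_mul_eq_zero F (Pi.single i 1) (by simp [h]) j
  simpa [Pi.single_apply, apply_ite] using this

theorem eq_zero_of_forall_innerProduct {F : MatPoly N} (h : ∀ G, W.innerProduct F G = 0) :
    F = 0 :=
  W.eq_zero_of_innerProduct_self (h F)

theorem posDef_innerProduct_self {F : MatPoly N} {n : ℕ} (hF : F.coeffMat n = 1) :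
    (W.innerProduct F F).PosDef := by
  refine Matrix.PosDef.of_dotProduct_mulVec_pos (W.innerProduct_conjTranspose F F) fun v hv => ?_
  refine lt_of_le_of_ne (W.dotProduct_innerProduct_mulVec_nonneg F v) fun h => hv ?_
  funext j
  have hj := congrArg (Polynomial.coeff · n) (W.sum_C_star_mul_eq_zero F v h.symm j)
  have hc (i) : (F i j).coeff n = (1 : Matrix (Fin N) (Fin N) ℂ) i j := by rw [← hF]; rfl
  simpa [hc, Matrix.one_apply, Polynomial.finsetSum_coeff] using hj

end WeightMatrix

/-! ### Monic orthogonal matrix polynomials -/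

namespace WeightMatrix

open MatPoly

variable {N : ℕ} (W : WeightMatrix N)

/-- The Gram–Schmidt process applied to `1, x, x², …`. -/
noncomputable def monicOrthogonal : ℕ → MatPoly N
  | n => (Polynomial.X : ℂ[X]) ^ n • 1 - ∑ k : Fin n,
      const (W.innerProduct ((Polynomial.X : ℂ[X]) ^ n • 1) (monicOrthogonal k) *
        (W.innerProduct (monicOrthogonal k) (monicOrthogonal k))⁻¹) * monicOrthogonal k
decreasing_by exact k.2

theorem monicOrthogonal_eq (n : ℕ) : W.monicOrthogonal n =
    (Polynomial.X : ℂ[X]) ^ n • 1 - ∑ k : Fin n,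
      const (W.innerProduct ((Polynomial.X : ℂ[X]) ^ n • 1) (W.monicOrthogonal k) *
        (W.innerProduct (W.monicOrthogonal k) (W.monicOrthogonal k))⁻¹) * W.monicOrthogonal k := by
  rw [monicOrthogonal]

theorem coeffMat_monicOrthogonal (n : ℕ) : ∀ k, n ≤ k →
    (W.monicOrthogonal n).coeffMat k = if k = n then 1 else 0 := by
  induction n using Nat.strong_induction_on with
  | _ n ih =>
    intro k hk
    rw [monicOrthogonal_eq, coeffMat_sub, coeffMat_X_pow_smul_one, coeffMat_sum,
      Finset.sum_eq_zero, sub_zero]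
    intro i _
    rw [coeffMat_const_mul, ih i i.2 k (i.2.le.trans hk), if_neg (by omega), mul_zero]

theorem posDef_innerProduct_monicOrthogonal (n : ℕ) :
    (W.innerProduct (W.monicOrthogonal n) (W.monicOrthogonal n)).PosDef :=
  W.posDef_innerProduct_self (n := n) (by simp [W.coeffMat_monicOrthogonal n n le_rfl])

theorem innerProduct_monicOrthogonal_of_lt (n : ℕ) : ∀ m, m < n →
    W.innerProduct (W.monicOrthogonal n) (W.monicOrthogonal m) = 0 := by
  induction n using Nat.strong_induction_on with
  | _ n ih =>
    intro m hm
    rw [monicOrthogonal_eq, innerProduct_sub_left, innerProduct_sum_left,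
      Finset.sum_eq_single (⟨m, hm⟩ : Fin n)]
    · rw [innerProduct_const_mul_left, mul_assoc, Matrix.nonsing_inv_mul _
        ((Matrix.isUnit_iff_isUnit_det _).1 (W.posDef_innerProduct_monicOrthogonal m).isUnit),
        mul_one, sub_self]
    · intro k _ hk
      rw [innerProduct_const_mul_left]
      rcases lt_or_gt_of_ne (fun h => hk (Fin.ext h) : (k : ℕ) ≠ m) with h | h
      · rw [← W.innerProduct_conjTranspose (W.monicOrthogonal m), ih m hm k h,
          Matrix.conjTranspose_zero, mul_zero]
      · rw [ih k k.2 m h, mul_zero]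
    · simp

theorem isMonicOrthogonalSequence_monicOrthogonal :
    W.IsMonicOrthogonalSequence W.monicOrthogonal where
  monic n := by simp [W.coeffMat_monicOrthogonal n n le_rfl]
  degree_le n k hk := by simp [W.coeffMat_monicOrthogonal n k hk.le, hk.ne']
  orthogonal n m hmn := by
    rcases lt_or_gt_of_ne hmn with h | h
    · exact W.innerProduct_monicOrthogonal_of_lt n m h
    · rw [← innerProduct_conjTranspose, W.innerProduct_monicOrthogonal_of_lt m n h,
        Matrix.conjTranspose_zero]

namespace IsMonicOrthogonalSequence

variable {W} {P : ℕ → MatPoly N}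

theorem exists_eq_sum (hP : W.IsMonicOrthogonalSequence P) (F : MatPoly N) :
    ∃ (d : ℕ) (c : ℕ → Matrix (Fin N) (Fin N) ℂ),
      F = ∑ k ∈ Finset.range d, const (c k) * P k := by
  obtain ⟨d, hd⟩ := F.exists_degree_bound
  exact ⟨d, exists_eq_sum_of_monic hP.monic hP.degree_le d F hd⟩

theorem isUnit_det (hP : W.IsMonicOrthogonalSequence P) (n : ℕ) :
    IsUnit (W.innerProduct (P n) (P n)).det :=
  (Matrix.isUnit_iff_isUnit_det _).1 (W.posDef_innerProduct_self (hP.monic n)).isUnit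

theorem innerProduct_sum (hP : W.IsMonicOrthogonalSequence P) (d : ℕ)
    (c : ℕ → Matrix (Fin N) (Fin N) ℂ) (m : ℕ) :
    W.innerProduct (∑ k ∈ Finset.range d, const (c k) * P k) (P m) =
      if m < d then c m * W.innerProduct (P m) (P m) else 0 := by
  simp only [innerProduct_sum_left, innerProduct_const_mul_left]
  split_ifs with h
  · refine Finset.sum_eq_single_of_mem m (Finset.mem_range.2 h) fun k _ hk => ?_
    rw [hP.orthogonal k m hk.symm, mul_zero]
  · refine Finset.sum_eq_zero fun k hk => ?_
    rw [hP.orthogonal k m (by rintro rfl; exact h (Finset.mem_range.1 hk)), mul_zero]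

theorem exists_eq_const_mul (hP : W.IsMonicOrthogonalSequence P) {F : MatPoly N} {n : ℕ}
    (hF : ∀ m, m ≠ n → W.innerProduct F (P m) = 0) : ∃ L, F = const L * P n := by
  obtain ⟨d, c, rfl⟩ := hP.exists_eq_sum F
  have hc (k) (hk : k ∈ Finset.range d) (hkn : k ≠ n) : const (c k) * P k = 0 := by
    have h := hF k hkn
    rw [hP.innerProduct_sum, if_pos (Finset.mem_range.1 hk)] at h
    have h2 : c k = 0 := by
      rw [← Matrix.mul_nonsing_inv_cancel_right _ (c k) (hP.isUnit_det k), h, zero_mul]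
    simp [h2, const]
  by_cases hn : n < d
  · exact ⟨c n, Finset.sum_eq_single_of_mem n (Finset.mem_range.2 hn) hc⟩
  · refine ⟨0, ?_⟩
    rw [Finset.sum_eq_zero fun k hk =>
      hc k hk (by rintro rfl; exact hn (Finset.mem_range.1 hk))]
    simp [const]

end IsMonicOrthogonalSequence

/-! ### Adjoints -/

/-- `E` is adjoint to `D`: `⟨E F, G⟩ = ⟨F, D G⟩`. -/
def IsAdjoint (D E : Module.End ℂ (MatPoly N)) : Prop :=
  ∀ F G, W.innerProduct (E F) G = W.innerProduct F (D G)

variable {W}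

theorem IsAdjoint.isLeftLinear {D E : Module.End ℂ (MatPoly N)} (h : W.IsAdjoint D E) :
    IsLeftLinear E := fun L F => sub_eq_zero.1 <| W.eq_zero_of_forall_innerProduct fun G => by
  rw [innerProduct_sub_left, innerProduct_const_mul_left, h, h, innerProduct_const_mul_left,
    sub_self]

theorem IsAdjoint.adX {D E : Module.End ℂ (MatPoly N)} (h : W.IsAdjoint D E) :
    W.IsAdjoint (-adX D) (adX E) := fun F G => by
  have hD : (-MatPoly.adX D) G =
      D ((Polynomial.X : ℂ[X]) • G) - (Polynomial.X : ℂ[X]) • D G := by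
    rw [LinearMap.neg_apply, adX_apply, neg_sub]
  rw [hD, adX_apply, innerProduct_sub_left, innerProduct_sub_right, innerProduct_X_smul, h, h,
    innerProduct_X_smul]

/-- Since `x` is symmetric for the inner product, iterated commutators with `x` vanish for an
operator when they vanish for its adjoint. -/
theorem IsAdjoint.adX_pow_eq_zero (m : ℕ) : ∀ {D E : Module.End ℂ (MatPoly N)},
    W.IsAdjoint D E → (MatPoly.adX ^ m) D = 0 → (MatPoly.adX ^ m) E = 0 := by
  induction m with
  | zero =>
    intro D E h hD
    simp only [pow_zero, Module.End.one_apply] at hD ⊢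
    ext1 F
    refine W.eq_zero_of_forall_innerProduct fun G => ?_
    rw [h, hD, LinearMap.zero_apply, ← W.innerProduct_conjTranspose 0]
    exact (congrArg Matrix.conjTranspose (map_zero (W.innerLeft F))).trans
      Matrix.conjTranspose_zero
  | succ m ih =>
    intro D E h hD
    rw [pow_succ, Module.End.mul_apply] at hD ⊢
    exact ih h.adX (by rw [map_neg, hD, neg_zero])

/-- A left linear operator with the `P(x,n)` as eigenfunctions has an adjoint: its value at `F` is
the finite orthogonal expansion `∑ₖ ⟨F, D Pₖ⟩ ⟨Pₖ, Pₖ⟩⁻¹ Pₖ`, where the terms with `k > deg F`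
would vanish. -/
theorem IsMonicOrthogonalSequence.exists_adjoint {P : ℕ → MatPoly N}
    (hP : W.IsMonicOrthogonalSequence P) {D : Module.End ℂ (MatPoly N)} (hD : IsLeftLinear D)
    (heig : ∀ n, ∃ L, D (P n) = const L * P n) : ∃ E, W.IsAdjoint D E := by
  have hex (F) : ∃ E, ∀ G, W.innerProduct E G = W.innerProduct F (D G) := by
    obtain ⟨d, c, hF⟩ := hP.exists_eq_sum F
    refine ⟨∑ k ∈ Finset.range d, const (W.innerProduct F (D (P k)) *
      (W.innerProduct (P k) (P k))⁻¹) * P k, fun G => ?_⟩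
    obtain ⟨e, b, rfl⟩ := hP.exists_eq_sum G
    simp only [map_sum, innerProduct_sum_right, hD _ _, innerProduct_const_mul_right]
    refine Finset.sum_congr rfl fun m _ => ?_
    congr 1
    rw [hP.innerProduct_sum]
    split_ifs with hm
    · rw [mul_assoc, Matrix.nonsing_inv_mul _ (hP.isUnit_det m), mul_one]
    · obtain ⟨L, hL⟩ := heig m
      rw [hL, innerProduct_const_mul_right, hF, hP.innerProduct_sum, if_neg hm, zero_mul]
  -- Nondegeneracy makes the value at `F` unique, hence linear in `F`.
  choose E hE using hex
  have hext {F G : MatPoly N} (h : ∀ K, W.innerProduct F K = W.innerProduct G K) : F = G :=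
    sub_eq_zero.1 <| W.eq_zero_of_forall_innerProduct fun K => by
      rw [innerProduct_sub_left, h, sub_self]
  refine ⟨{ toFun := E, map_add' := fun F G => hext fun K => ?_,
            map_smul' := fun r F => hext fun K => ?_ }, fun F G => hE F G⟩
  · rw [hE, innerProduct_add_left, innerProduct_add_left, hE, hE]
  · rw [hE, RingHom.id_apply, innerProduct_smul_left, innerProduct_smul_left, hE]

/-- The algebra `𝒟(W)` is closed under adjoints: the adjoint is a differential operator by the
commutator criterion, and it maps `P(x,n)` to a polynomial orthogonal to all other `P(x,m)`. -/
theorem exists_adjoint_mem_diffOpAlgebra {D : (Module.End ℂ (MatPoly N))ᵐᵒᵖ}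
    (hD : D ∈ W.diffOpAlgebra) : ∃ E ∈ W.diffOpAlgebra, W.IsAdjoint D.unop E.unop := by
  obtain ⟨hD, heig⟩ := hD
  obtain ⟨hlin, m, hm⟩ := MatDiffOp.mem_matDiffOps_iff.1 hD
  have hP := W.isMonicOrthogonalSequence_monicOrthogonal
  obtain ⟨E, hE⟩ := hP.exists_adjoint hlin (heig _ hP)
  refine ⟨MulOpposite.op E, ⟨MatDiffOp.mem_matDiffOps_iff.2
    ⟨hE.isLeftLinear, m, hE.adX_pow_eq_zero m hm⟩, fun P hP n => ?_⟩, hE⟩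
  refine hP.exists_eq_const_mul fun k hk => ?_
  obtain ⟨L, hL⟩ := heig P hP k
  rw [MulOpposite.unop_op, hE, hL, innerProduct_const_mul_right, hP.orthogonal n k hk, zero_mul]

/-! ### The eigenvalues -/

variable (W)

/-- The leading coefficient of `P(x,n) · 𝔇`; for `𝔇 ∈ 𝒟(W)` this is the eigenvalue `Λ(n)`. -/
noncomputable def eigenvalue (D : (Module.End ℂ (MatPoly N))ᵐᵒᵖ) (n : ℕ) :
    Matrix (Fin N) (Fin N) ℂ :=
  coeffMat (D.unop (W.monicOrthogonal n)) n

variable {W}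

theorem eigenvalue_eq_of_apply_eq {D : (Module.End ℂ (MatPoly N))ᵐᵒᵖ} {n : ℕ}
    {L : Matrix (Fin N) (Fin N) ℂ}
    (h : D.unop (W.monicOrthogonal n) = const L * W.monicOrthogonal n) :
    W.eigenvalue D n = L := by
  rw [eigenvalue, h, coeffMat_const_mul,
    W.isMonicOrthogonalSequence_monicOrthogonal.monic, mul_one]

theorem apply_monicOrthogonal {D : (Module.End ℂ (MatPoly N))ᵐᵒᵖ} (hD : D ∈ W.diffOpAlgebra)
    (n : ℕ) :
    D.unop (W.monicOrthogonal n) = const (W.eigenvalue D n) * W.monicOrthogonal n := by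
  obtain ⟨L, hL⟩ := hD.2 _ W.isMonicOrthogonalSequence_monicOrthogonal n
  rw [eigenvalue_eq_of_apply_eq hL, hL]

theorem isLeftLinear_of_mem {D : (Module.End ℂ (MatPoly N))ᵐᵒᵖ} (hD : D ∈ W.diffOpAlgebra) :
    IsLeftLinear D.unop := (MatDiffOp.mem_matDiffOps_iff.1 hD.1).1

theorem eq_of_eigenvalue_eq {D E : (Module.End ℂ (MatPoly N))ᵐᵒᵖ} (hD : D ∈ W.diffOpAlgebra)
    (hE : E ∈ W.diffOpAlgebra) (h : ∀ n, W.eigenvalue D n = W.eigenvalue E n) : D = E := by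
  refine MulOpposite.unop_injective (LinearMap.ext fun F => ?_)
  obtain ⟨d, c, rfl⟩ := W.isMonicOrthogonalSequence_monicOrthogonal.exists_eq_sum F
  simp only [map_sum, isLeftLinear_of_mem hD _ _, isLeftLinear_of_mem hE _ _,
    apply_monicOrthogonal hD, apply_monicOrthogonal hE, h]

theorem eigenvalue_mul {D E : (Module.End ℂ (MatPoly N))ᵐᵒᵖ} (hD : D ∈ W.diffOpAlgebra)
    (hE : E ∈ W.diffOpAlgebra) (n : ℕ) :
    W.eigenvalue (D * E) n = W.eigenvalue D n * W.eigenvalue E n := by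
  refine eigenvalue_eq_of_apply_eq ?_
  rw [MulOpposite.unop_mul, Module.End.mul_apply, apply_monicOrthogonal hD,
    isLeftLinear_of_mem hE, apply_monicOrthogonal hE, const_mul, mul_assoc]

theorem eigenvalue_add (D E : (Module.End ℂ (MatPoly N))ᵐᵒᵖ) (n : ℕ) :
    W.eigenvalue (D + E) n = W.eigenvalue D n + W.eigenvalue E n := by
  simp [eigenvalue, coeffMat_add]

theorem eigenvalue_algebraMap (r : ℂ) (n : ℕ) :
    W.eigenvalue (algebraMap ℂ _ r) n = r • (1 : Matrix (Fin N) (Fin N) ℂ) := by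
  refine eigenvalue_eq_of_apply_eq ?_
  rw [const_smul_one]
  simp [MulOpposite.algebraMap_apply, Module.algebraMap_end_apply]

/-- On eigenvalues, the adjoint is the conjugate transpose twisted by the squared norms. -/
theorem eigenvalue_mul_innerProduct_of_isAdjoint {D E : (Module.End ℂ (MatPoly N))ᵐᵒᵖ}
    (hD : D ∈ W.diffOpAlgebra) (hE : E ∈ W.diffOpAlgebra) (h : W.IsAdjoint D.unop E.unop) (n : ℕ) :
    W.eigenvalue E n * W.innerProduct (W.monicOrthogonal n) (W.monicOrthogonal n) =
      W.innerProduct (W.monicOrthogonal n) (W.monicOrthogonal n) * (W.eigenvalue D n)ᴴ := by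
  rw [← innerProduct_const_mul_left, ← apply_monicOrthogonal hE, h, apply_monicOrthogonal hD,
    innerProduct_const_mul_right]

theorem coeffMat_act_X_pow (A : ℕ →₀ MatPoly N) (n : ℕ) :
    coeffMat (MatDiffOp.act A ((Polynomial.X : ℂ[X]) ^ n • 1)) n =
      ∑ j ∈ A.support, (n.descFactorial j : ℂ) • coeffMat (A j) j := by
  rw [MatDiffOp.act, Finsupp.sum, coeffMat_sum]
  refine Finset.sum_congr rfl fun j _ => ?_
  have h : (Polynomial.X : ℂ[X]) ^ n • (1 : MatPoly N) =
      Matrix.scalar (Fin N) ((Polynomial.X : ℂ[X]) ^ n) := by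
    rw [Matrix.smul_one_eq_diagonal]; rfl
  rw [h, MatDiffOp.deriv_pow_X_pow, Polynomial.iterate_derivative_X_pow_eq_smul]
  ext a b
  rcases le_or_gt j n with hj | hj
  · have : (Polynomial.X ^ (n - j) * A j a b).coeff n = (A j a b).coeff j := by
      rw [Polynomial.coeff_X_pow_mul', if_pos (Nat.sub_le n j), Nat.sub_sub_self hj]
    simp [coeffMat, Matrix.scalar_apply, Matrix.diagonal_mul, this]
  · simp [coeffMat, Nat.descFactorial_eq_zero_iff_lt.2 hj]

/-- The eigenvalues are polynomial in `n`: only the coefficients of `xʲ` in `Aⱼ` contribute to the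
leading coefficient of `P(x,n) · 𝔇`. -/
theorem exists_eigenvalue_eq_sum {D : (Module.End ℂ (MatPoly N))ᵐᵒᵖ} (hD : D ∈ W.diffOpAlgebra) :
    ∃ A : ℕ →₀ MatPoly N, ∀ n,
      W.eigenvalue D n = ∑ j ∈ A.support, (n.descFactorial j : ℂ) • coeffMat (A j) j := by
  obtain ⟨A, hA⟩ := hD.1
  refine ⟨A, fun n => ?_⟩
  have hP := W.isMonicOrthogonalSequence_monicOrthogonal
  obtain ⟨c, hc⟩ := exists_eq_sum_of_monic hP.monic hP.degree_le n
    (W.monicOrthogonal n - (Polynomial.X : ℂ[X]) ^ n • 1) fun k hk => by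
      rw [coeffMat_sub, W.coeffMat_monicOrthogonal n k hk, coeffMat_X_pow_smul_one, sub_self]
  -- `𝔇` does not raise degrees, so the terms of degree less than `n` do not contribute.
  have hlow : coeffMat (D.unop (W.monicOrthogonal n - (Polynomial.X : ℂ[X]) ^ n • 1)) n = 0 := by
    rw [hc, map_sum, coeffMat_sum]
    refine Finset.sum_eq_zero fun k hk => ?_
    rw [isLeftLinear_of_mem hD, apply_monicOrthogonal hD, coeffMat_const_mul, coeffMat_const_mul,
      hP.degree_le k n (Finset.mem_range.1 hk), mul_zero, mul_zero]
  rw [← coeffMat_act_X_pow, ← hA, eigenvalue]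
  rw [map_sub, coeffMat_sub] at hlow
  exact sub_eq_zero.1 hlow

theorem exists_trace_eigenvalue_eq_eval {D : (Module.End ℂ (MatPoly N))ᵐᵒᵖ}
    (hD : D ∈ W.diffOpAlgebra) :
    ∃ f : ℂ[X], ∀ n : ℕ, (W.eigenvalue D n).trace = f.eval (n : ℂ) := by
  obtain ⟨A, hA⟩ := exists_eigenvalue_eq_sum hD
  refine ⟨∑ j ∈ A.support, descPochhammer ℂ j * Polynomial.C (coeffMat (A j) j).trace,
    fun n => ?_⟩
  rw [hA, Matrix.trace_sum, Polynomial.eval_finsetSum]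
  refine Finset.sum_congr rfl fun j _ => ?_
  rw [Matrix.trace_smul, Polynomial.eval_mul, Polynomial.eval_C,
    descPochhammer_eval_eq_descFactorial, smul_eq_mul]

/-- The eigenvalues `S(n)⁻¹ Λ(n) S(n)` of `𝔇` with respect to the orthogonal polynomials
`S(n)⁻¹ P(x,n)`. -/
noncomputable def conjEigenvalue (S : ℕ → (Matrix (Fin N) (Fin N) ℂ)ˣ) :
    W.diffOpAlgebra →ₐ[ℂ] (ℕ → Matrix (Fin N) (Fin N) ℂ) where
  toFun D n := (S n)⁻¹.1 * W.eigenvalue D n * (S n).1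
  map_one' := by
    funext n
    have := eigenvalue_algebraMap (W := W) 1 n
    rw [map_one, one_smul] at this
    simp [this]
  map_mul' D E := by
    funext n
    simp [eigenvalue_mul D.2 E.2, mul_assoc]
  map_zero' := by
    funext n
    have := eigenvalue_algebraMap (W := W) 0 n
    rw [map_zero, zero_smul] at this
    simp [this]
  map_add' D E := by
    funext n
    simp [eigenvalue_add, mul_add, add_mul]
  commutes' r := by
    funext n
    have := eigenvalue_algebraMap (W := W) r n
    rw [Subalgebra.coe_algebraMap, this]
    simp [Algebra.algebraMap_eq_smul_one]

theorem conjEigenvalue_apply (S : ℕ → (Matrix (Fin N) (Fin N) ℂ)ˣ) (D : W.diffOpAlgebra) (n : ℕ) :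
    conjEigenvalue S D n = (S n)⁻¹.1 * W.eigenvalue D n * (S n).1 := rfl

end WeightMatrix

/-! ### Finite generation -/

open scoped MatrixOrder Matrix.Norms.L2Operator in
theorem Matrix.PosDef.exists_unit_eq_mul_conjTranspose {ι : Type*} [Fintype ι] [DecidableEq ι]
    {H : Matrix ι ι ℂ} (hH : H.PosDef) : ∃ S : (Matrix ι ι ℂ)ˣ, H = S.1 * S.1ᴴ := by
  obtain ⟨B, hB⟩ := CStarAlgebra.nonneg_iff_eq_star_mul_self.1 hH.posSemidef.nonneg
  have hu : IsUnit (star B).det := by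
    have := (Matrix.isUnit_iff_isUnit_det _).1 hH.isUnit
    rw [hB, Matrix.det_mul] at this
    exact isUnit_of_mul_isUnit_left this
  obtain ⟨S, hS⟩ := (Matrix.isUnit_iff_isUnit_det _).2 hu
  exact ⟨S, by rw [hS, hB, Matrix.star_eq_conjTranspose, Matrix.conjTranspose_conjTranspose]⟩

theorem mainTheorem4 (N : ℕ) (W : WeightMatrix N) :
    Algebra.FiniteType ℂ W.diffOpAlgebra := by
  choose S hS using fun n =>
    (W.posDef_innerProduct_monicOrthogonal n).exists_unit_eq_mul_conjTranspose
  refine Algebra.FiniteType.of_star_closed_of_polynomial_trace (A := W.diffOpAlgebra)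
    (WeightMatrix.conjEigenvalue S) ?_ ?_ ?_
  · intro D E h
    refine Subtype.ext (WeightMatrix.eq_of_eigenvalue_eq D.2 E.2 fun n => ?_)
    have hn := congrFun h n
    simp only [WeightMatrix.conjEigenvalue_apply] at hn
    exact (Units.mul_right_inj _).1 ((Units.mul_left_inj _).1 hn)
  · intro D
    obtain ⟨E, hE, hadj⟩ := WeightMatrix.exists_adjoint_mem_diffOpAlgebra D.2
    refine ⟨⟨E, hE⟩, fun n => ?_⟩
    have h := WeightMatrix.eigenvalue_mul_innerProduct_of_isAdjoint D.2 hE hadj n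
    rw [hS n] at h
    simp only [WeightMatrix.conjEigenvalue_apply, Matrix.conjTranspose_mul]
    have hinv : (S n).1ᴴ * ((S n)⁻¹.1)ᴴ = 1 := by
      rw [← Matrix.conjTranspose_mul, Units.inv_mul, Matrix.conjTranspose_one]
    calc (S n)⁻¹.1 * W.eigenvalue E n * (S n).1
        = (S n)⁻¹.1 * (W.eigenvalue E n * ((S n).1 * (S n).1ᴴ)) * ((S n)⁻¹.1)ᴴ := by
          simp only [mul_assoc, hinv, mul_one]
      _ = (S n).1ᴴ * ((W.eigenvalue D n)ᴴ * ((S n)⁻¹.1)ᴴ) := by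
          rw [h]
          simp only [mul_assoc, Units.inv_mul_cancel_left]
  · intro D
    obtain ⟨f, hf⟩ := WeightMatrix.exists_trace_eigenvalue_eq_eval D.2
    refine ⟨f, fun n => ?_⟩
    rw [WeightMatrix.conjEigenvalue_apply, mul_assoc, Matrix.trace_mul_comm, mul_assoc,
      Units.mul_inv, mul_one, hf]
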